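/- Let $(M,g)$ be a Kähler manifold of complex dimension $n$, with complex structure $J$ and fundamental form $\omega(u,v)=g(Ju,v)$. Let $P\to M$ be a smooth principal $G$-bundle, where $G$ is a (finite-dimensional, real) Lie group with Lie algebra $\mathfrak g$, and let $A$ be a smooth connection on $P$, with curvature $F_A\in\Omega^2(\mathfrak g_P)$, where $\mathfrak g_P=P\times_{\mathrm{Ad}}\mathfrak g$. Write $d_A=\partial_A+\bar\partial_A$ for the splitting of the covariant exterior derivative on $\mathfrak g_P\otimes\mathbb C$-valued forms by type, $F_A=F_A^{2,0}+F_A^{1,1}+F_A^{0,2}$ for the decomposition of the curvature by type, and $\hat F_A=\Lambda_\omega F_A$, where $\Lambda_\omega$ is the adjoint of $\alpha\mapsto\omega\wedge\alpha$. Let $d_A^*=-{*}\,d_A\,{*}$, $\partial_A^*=-{*}\,\bar\partial_A\,{*}$, $\bar\partial_A^*=-{*}\,\partial_A\,{*}$ be the formal adjoints of $d_A$, $\partial_A$, $\bar\partial_A$, where $*$ is the complex-linear Hodge star of $g$. If $A$ is a Yang–Mills connection, i.e. $d_A^*F_A=0$, then $$2\,\bar\partial_A^*F_A^{0,2}=\sqrt{-1}\,\bar\partial_A\hat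 F_A\qquad\text{and}\qquad 2\,\partial_A^*F_A^{2,0}=-\sqrt{-1}\,\partial_A\hat F_A .$$ -/

import Mathlib

open scoped Manifold ContDiff MulOpposite

noncomputable section

namespace KaehlerYM

/-! ### Linear algebra on a complex vector space `E` with a Hermitian metric

`E` is the model space `ℂⁿ`.  All forms are real-multilinear alternating forms on the
underlying real vector space of `E`. -/

section LinearAlgebra

variable (E : Type*) [NormedAddCommGroup E] [NormedSpace ℂ E]

/-- The standard complex structure `J v = √-1 v`, as a real-linear map. -/
def J : E →L[ℝ] E := Complex.I • ContinuousLinearMap.id ℝ E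

@[simp] theorem J_apply (v : E) : J E v = Complex.I • v := rfl

variable {E}

/-- The fundamental form `ω(u, v) = g(J u, v)` of a `J`-invariant symmetric bilinear form `g`
(see `fundForm_apply`). In general it is the alternating part of `(u, v) ↦ g(J u, v)`. -/
def fundForm (g : E →L[ℝ] E →L[ℝ] ℝ) : E [⋀^Fin 2]→L[ℝ] ℝ :=
  (1 / 2 : ℝ) • ContinuousAlternatingMap.alternatizeUncurryFin
    (((ContinuousAlternatingMap.ofSubsingletonLIE (𝕜 := ℝ) (E := E) (F := ℝ)
      (0 : Fin 1)).toContinuousLinearEquiv.toContinuousLinearMap).comp (g.comp (J E)))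

theorem fundForm_apply (g : E →L[ℝ] E →L[ℝ] ℝ) (hs : ∀ u v, g u v = g v u)
    (hJ : ∀ u v, g (J E u) (J E v) = g u v) (v : Fin 2 → E) :
    fundForm g v = g (J E (v 0)) (v 1) := by
  have hJJ : ∀ u : E, J E (J E u) = -u := fun u => by simp [smul_smul]
  have h2 : g (J E (v 1)) (v 0) = - g (J E (v 0)) (v 1) := by
    rw [← hJ (J E (v 1)), hJJ, hs, map_neg]
  have h3 : fundForm g v = (1 / 2 : ℝ) * (g (J E (v 0)) (v 1) - g (J E (v 1)) (v 0)) := by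
    simp [fundForm, ContinuousAlternatingMap.alternatizeUncurryFin_apply, Fin.sum_univ_two,
      Fin.removeNth, sub_eq_add_neg]
  rw [h3, h2]
  ring

variable (E) [FiniteDimensional ℂ E]

/-- The real dimension `2 n` of a complex vector space of complex dimension `n`. -/
abbrev rdim : ℕ := Module.finrank ℂ E * 2

/-- A fixed real basis `b₁, √-1 b₁, b₂, √-1 b₂, …` of `E`; it is positively oriented for the complex
orientation. -/
def rbasis : Module.Basis (Fin (rdim E)) ℝ E :=
  (Complex.basisOneI.smulTower' (Module.finBasis ℂ E)).reindex finProdFinEquiv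

variable {E}

/-- The Gram matrix `g_{ab} = g(e_a, e_b)` in the fixed real basis. -/
def gram (g : E →L[ℝ] E →L[ℝ] ℝ) : Matrix (Fin (rdim E)) (Fin (rdim E)) ℝ :=
  Matrix.of fun a b => g (rbasis E a) (rbasis E b)

/-- The reciprocal vectors `e^a = ∑_b g^{ab} e_b`, where `(g^{ab})` is the inverse Gram matrix:
these are the metric duals of the dual basis, so that `g(e^a, e_b) = δ_{ab}`.  For an orthonormal
basis, `e^a = e_a`. -/
def recip (g : E →L[ℝ] E →L[ℝ] ℝ) (a : Fin (rdim E)) : E :=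
  ∑ b, (gram g)⁻¹ a b • rbasis E b

/-- The determinant form of the fixed real basis, as a continuous alternating form in `N = 2 n`
arguments. -/
def detForm {N : ℕ} (h : N = rdim E) : E [⋀^Fin N]→L[ℝ] ℝ :=
  { ((rbasis E).reindex (finCongr h.symm)).det with
    cont := by
      change Continuous fun v : Fin N → E => ((rbasis E).reindex (finCongr h.symm)).det v
      simp only [Module.Basis.det_apply]
      refine Continuous.matrix_det (continuous_matrix fun i j => ?_)
      change Continuous fun v : Fin N → E =>
        ((rbasis E).reindex (finCongr h.symm)).coord i (v j)
      exact (LinearMap.continuous_of_finiteDimensional _).comp (continuous_apply j) }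

/-- The Riemannian volume form `√det(g_{ab}) e¹ ∧ ⋯ ∧ e²ⁿ`, in `N = 2 n` arguments. -/
def volForm (g : E →L[ℝ] E →L[ℝ] ℝ) {N : ℕ} (h : N = rdim E) : E [⋀^Fin N]→L[ℝ] ℝ :=
  Real.sqrt (gram g).det • detForm h

variable {W : Type*} [NormedAddCommGroup W] [NormedSpace ℝ W]

/-- Insert the vectors `a 0, …, a (k - 1)` in the first `k` slots of an alternating form:
the result is `v ↦ α(a 0, …, a (k - 1), v 0, …, v (l - 1))`. -/
def insertFirst : {k : ℕ} → (Fin k → E) → {l : ℕ} → E [⋀^Fin (l + k)]→L[ℝ] ℝ → E [⋀^Fin l]→L[ℝ] ℝ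
  | 0, _, _, α => α
  | _ + 1, a, _, α => insertFirst (Fin.tail a) (α.curryLeft (a 0))

/-- The Hodge star of a `W`-valued `k`-form, as an `l`-form, where `l + k = 2 n`:
`(∗φ)(v₁, …, v_l) = (1 / k!) ∑_{i₁, …, i_k} vol(e^{i₁}, …, e^{i_k}, v₁, …, v_l) φ(e_{i₁}, …, e_{i_k})`.
If `l + k ≠ 2 n` then it is `0`. -/
def hodge (g : E →L[ℝ] E →L[ℝ] ℝ) {k : ℕ} (l : ℕ) (φ : E [⋀^Fin k]→L[ℝ] W) : E [⋀^Fin l]→L[ℝ] W :=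
  if h : l + k = rdim E then
    (1 / (k.factorial : ℝ)) • ∑ i : Fin k → Fin (rdim E),
      (ContinuousLinearMap.toSpanSingleton ℝ
        (φ fun j => rbasis E (i j))).compContinuousAlternatingMap
        (insertFirst (fun j => recip g (i j)) (volForm g h))
  else 0

/-- The contraction `Λ_ω` with the fundamental form, i.e. the adjoint of `ω ∧ ·`:
`Λ α = (1 / 2) ∑_a α(e_a, J e^a, ⋯)`, that is, `∑_j α(u_j, J u_j, ⋯)` for a unitary basis `u_j`. -/
def contractOmega (g : E →L[ℝ] E →L[ℝ] ℝ) {k : ℕ} (α : E [⋀^Fin (k + 2)]→L[ℝ] W) :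
    E [⋀^Fin k]→L[ℝ] W :=
  (1 / 2 : ℝ) • ∑ a, (α.curryLeft (rbasis E a)).curryLeft (J E (recip g a))

end LinearAlgebra

/-! ### Complexification and types

The complexification `V ⊗ ℂ = V ⊕ √-1 V` of a real vector space `V` is represented by `V × V`, the
pair `(x, y)` standing for `x + √-1 y`. -/

section Complexification

/-- Multiplication by `√-1` on `V ⊗ ℂ`: `√-1 (x + √-1 y) = -y + √-1 x`. -/
def imul (V : Type*) [NormedAddCommGroup V] [NormedSpace ℝ V] : V × V →L[ℝ] V × V :=
  (-ContinuousLinearMap.snd ℝ V V).prod (ContinuousLinearMap.fst ℝ V V)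

variable {E : Type*} [NormedAddCommGroup E] [NormedSpace ℂ E]
variable {V : Type*} [NormedAddCommGroup V] [NormedSpace ℝ V]

/-- Multiplication by `√-1` on `V ⊗ ℂ`-valued forms. -/
def imulForm {k : ℕ} (α : E [⋀^Fin k]→L[ℝ] (V × V)) : E [⋀^Fin k]→L[ℝ] (V × V) :=
  (imul V).compContinuousAlternatingMap α

/-- A `V`-valued form as a `V ⊗ ℂ`-valued form. -/
def complexify {k : ℕ} (α : E [⋀^Fin k]→L[ℝ] V) : E [⋀^Fin k]→L[ℝ] (V × V) :=
  (ContinuousLinearMap.inl ℝ V V).compContinuousAlternatingMap α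

/-- The `2`-form `(u, v) ↦ α(J u, v) + α(u, J v)`. -/
def derJ (α : E [⋀^Fin 2]→L[ℝ] (V × V)) : E [⋀^Fin 2]→L[ℝ] (V × V) :=
  ContinuousAlternatingMap.alternatizeUncurryFin (α.curryLeft.comp (J E))

/-- The `(2,0)`-part of a complex `2`-form: its complex-bilinear part
`α^{2,0}(u, v) = (1/4) (α(u, v) - α(J u, J v) - √-1 (α(J u, v) + α(u, J v)))`,
i.e. `α` evaluated on the projections `(u - √-1 J u) / 2`, `(v - √-1 J v) / 2` to `T^{1,0}`. -/
def part20 (α : E [⋀^Fin 2]→L[ℝ] (V × V)) : E [⋀^Fin 2]→L[ℝ] (V × V) :=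
  (1 / 4 : ℝ) • (α - α.compContinuousLinearMap (J E) - imulForm (derJ α))

/-- The `(0,2)`-part of a complex `2`-form: its conjugate-bilinear part
`α^{0,2}(u, v) = (1/4) (α(u, v) - α(J u, J v) + √-1 (α(J u, v) + α(u, J v)))`,
i.e. `α` evaluated on the projections `(u + √-1 J u) / 2`, `(v + √-1 J v) / 2` to `T^{0,1}`. -/
def part02 (α : E [⋀^Fin 2]→L[ℝ] (V × V)) : E [⋀^Fin 2]→L[ℝ] (V × V) :=
  (1 / 4 : ℝ) • (α - α.compContinuousLinearMap (J E) + imulForm (derJ α))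

theorem derJ_apply (α : E [⋀^Fin 2]→L[ℝ] (V × V)) (u v : E) :
    derJ α ![u, v] = α ![J E u, v] + α ![u, J E v] := by
  have h : α ![J E v, u] = -α ![u, J E v] := by
    have := α.toAlternatingMap.map_swap ![u, J E v] (i := 0) (j := 1) (by decide)
    have e : ![u, J E v] ∘ Equiv.swap (0 : Fin 2) 1 = ![J E v, u] := by
      ext i; fin_cases i <;> simp
    rw [e] at this
    exact this
  have h1 : ∀ x y : E, (α.curryLeft x) (fun _ : Fin 1 => y) = α ![x, y] := fun x y => by
    rw [ContinuousAlternatingMap.curryLeft_apply_apply]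
    congr 1
    ext i; fin_cases i <;> rfl
  rw [derJ, ContinuousAlternatingMap.alternatizeUncurryFin_apply, Fin.sum_univ_two]
  have r0 : Fin.removeNth 0 ![u, v] = fun _ : Fin 1 => v := by
    ext i; fin_cases i; rfl
  have r1 : Fin.removeNth 1 ![u, v] = fun _ : Fin 1 => u := by
    ext i; fin_cases i; rfl
  rw [r0, r1]
  simp only [J_apply] at h
  simp [h1, h]

end Complexification

/-! ### Local covariant exterior calculus

Forms on (an open subset of) the coordinate space `E`, with values in a vector space `W` on which a
Lie algebra `𝔤` acts through `ρ`.  A connection in a local gauge is a `𝔤`-valued `1`-form `a`. -/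

section LocalCalculus

variable {E : Type*} [NormedAddCommGroup E] [NormedSpace ℂ E] [FiniteDimensional ℂ E]
variable {𝔤 : Type*} [NormedAddCommGroup 𝔤] [NormedSpace ℝ 𝔤]
variable {W : Type*} [NormedAddCommGroup W] [NormedSpace ℝ W]

/-- The map `v ↦ ρ(a(v)) φ`, for a `W`-valued form `φ` at a point. -/
def actForm (ρ : 𝔤 →L[ℝ] W →L[ℝ] W) (a : E →L[ℝ] 𝔤) {k : ℕ} (φ : E [⋀^Fin k]→L[ℝ] W) :
    E →L[ℝ] E [⋀^Fin k]→L[ℝ] W :=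
  LinearMap.toContinuousLinearMap
    { toFun := fun v => (ρ (a v)).compContinuousAlternatingMap φ
      map_add' := fun u v => by ext; simp
      map_smul' := fun r v => by ext; simp }

/-- The derivative `v ↦ ∂_v φ + ρ(a(v)) φ` of a form, component by component in the linear
coordinates of `E`. Its alternation is the covariant exterior derivative. -/
def covDeriv (ρ : 𝔤 →L[ℝ] W →L[ℝ] W) (a : E → E →L[ℝ] 𝔤) {k : ℕ} (φ : E → E [⋀^Fin k]→L[ℝ] W)
    (y : E) : E →L[ℝ] E [⋀^Fin k]→L[ℝ] W :=
  fderiv ℝ φ y + actForm ρ (a y) (φ y)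

/-- The covariant exterior derivative `d_a φ = dφ + [a ∧ φ]`. -/
def dCov (ρ : 𝔤 →L[ℝ] W →L[ℝ] W) (a : E → E →L[ℝ] 𝔤) {k : ℕ} (φ : E → E [⋀^Fin k]→L[ℝ] W)
    (y : E) : E [⋀^Fin (k + 1)]→L[ℝ] W :=
  .alternatizeUncurryFin (covDeriv ρ a φ y)

theorem dCov_eq (ρ : 𝔤 →L[ℝ] W →L[ℝ] W) (a : E → E →L[ℝ] 𝔤) {k : ℕ}
    (φ : E → E [⋀^Fin k]→L[ℝ] W) (y : E) :
    dCov ρ a φ y = extDeriv φ y + .alternatizeUncurryFin (actForm ρ (a y) (φ y)) := by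
  simp [dCov, covDeriv, extDeriv]

/-- A `𝔤`-valued linear form as an alternating `1`-form. -/
def oneForm (a : E →L[ℝ] 𝔤) : E [⋀^Fin 1]→L[ℝ] 𝔤 :=
  ContinuousAlternatingMap.ofSubsingleton ℝ E 𝔤 (0 : Fin 1) a

/-- The curvature `F = da + (1/2) [a ∧ a]`, where `ad` is the adjoint action `ad x y = [x, y]`. -/
def curv (ad : 𝔤 →L[ℝ] 𝔤 →L[ℝ] 𝔤) (a : E → E →L[ℝ] 𝔤) (y : E) : E [⋀^Fin 2]→L[ℝ] 𝔤 :=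
  extDeriv (fun z => oneForm (a z)) y
    + (1 / 2 : ℝ) • .alternatizeUncurryFin (actForm ad (a y) (oneForm (a y)))

/-- The codifferential `d_a^* = -∗ d_a ∗` on `(k+1)`-forms (the real dimension is even), for the
Riemannian metric `g`. -/
def dCovStar (g : E → E →L[ℝ] E →L[ℝ] ℝ) (ρ : 𝔤 →L[ℝ] W →L[ℝ] W) (a : E → E →L[ℝ] 𝔤) {k : ℕ}
    (φ : E → E [⋀^Fin (k + 1)]→L[ℝ] W) (y : E) : E [⋀^Fin k]→L[ℝ] W :=
  -hodge (g y) k (dCov ρ a (fun z => hodge (g z) (rdim E - (k + 1)) (φ z)) y)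

/-- The diagonal action of `𝔤` on `𝔤 ⊗ ℂ`, that is `ad x (y + √-1 z) = [x, y] + √-1 [x, z]`. -/
def adC (ad : 𝔤 →L[ℝ] 𝔤 →L[ℝ] 𝔤) : 𝔤 →L[ℝ] (𝔤 × 𝔤) →L[ℝ] (𝔤 × 𝔤) :=
  (ContinuousLinearMap.prodMapL ℝ 𝔤 𝔤 𝔤 𝔤).comp (ad.prod ad)

/-- The operator `T ↦ √-1 T` on linear maps with values in complex forms. -/
def imulCLM {k : ℕ} (T : E →L[ℝ] E [⋀^Fin k]→L[ℝ] (𝔤 × 𝔤)) :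
    E →L[ℝ] E [⋀^Fin k]→L[ℝ] (𝔤 × 𝔤) :=
  LinearMap.toContinuousLinearMap
    { toFun := fun v => imulForm (T v)
      map_add' := fun u v => by ext <;> simp [imulForm]
      map_smul' := fun r v => by ext <;> simp [imulForm] }

/-- The operator `∂_a` on `𝔤 ⊗ ℂ`-valued forms: with `∇_v φ = ∂_v φ + [a(v), φ]` in holomorphic
coordinates, it is the alternation of the `(1,0)`-part `v ↦ (1/2) (∇_v φ - √-1 ∇_{J v} φ)`, i.e.
`∂_a φ = ∑_j dz_j ∧ ∇_{∂/∂z_j} φ = ∂φ + [a^{1,0} ∧ φ]`. -/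
def del (ad : 𝔤 →L[ℝ] 𝔤 →L[ℝ] 𝔤) (a : E → E →L[ℝ] 𝔤) {k : ℕ}
    (φ : E → E [⋀^Fin k]→L[ℝ] (𝔤 × 𝔤)) (y : E) : E [⋀^Fin (k + 1)]→L[ℝ] (𝔤 × 𝔤) :=
  .alternatizeUncurryFin ((1 / 2 : ℝ) •
    (covDeriv (adC ad) a φ y - imulCLM ((covDeriv (adC ad) a φ y).comp (J E))))

/-- The operator `∂̄_a` on `𝔤 ⊗ ℂ`-valued forms: the alternation of the `(0,1)`-part
`v ↦ (1/2) (∇_v φ + √-1 ∇_{J v} φ)`, i.e. `∂̄_a φ = ∑_j dz̄_j ∧ ∇_{∂/∂z̄_j} φ`. -/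
def delbar (ad : 𝔤 →L[ℝ] 𝔤 →L[ℝ] 𝔤) (a : E → E →L[ℝ] 𝔤) {k : ℕ}
    (φ : E → E [⋀^Fin k]→L[ℝ] (𝔤 × 𝔤)) (y : E) : E [⋀^Fin (k + 1)]→L[ℝ] (𝔤 × 𝔤) :=
  .alternatizeUncurryFin ((1 / 2 : ℝ) •
    (covDeriv (adC ad) a φ y + imulCLM ((covDeriv (adC ad) a φ y).comp (J E))))

theorem del_add_delbar (ad : 𝔤 →L[ℝ] 𝔤 →L[ℝ] 𝔤) (a : E → E →L[ℝ] 𝔤) {k : ℕ}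
    (φ : E → E [⋀^Fin k]→L[ℝ] (𝔤 × 𝔤)) (y : E) :
    del ad a φ y + delbar ad a φ y = dCov (adC ad) a φ y := by
  rw [del, delbar, dCov, ← ContinuousAlternatingMap.alternatizeUncurryFin_add]
  congr 1
  module

/-- The formal adjoint `∂_a^* = -∗ ∂̄_a ∗` of `∂_a`, on `(k+1)`-forms. -/
def delStar (g : E → E →L[ℝ] E →L[ℝ] ℝ) (ad : 𝔤 →L[ℝ] 𝔤 →L[ℝ] 𝔤) (a : E → E →L[ℝ] 𝔤) {k : ℕ}
    (φ : E → E [⋀^Fin (k + 1)]→L[ℝ] (𝔤 × 𝔤)) (y : E) : E [⋀^Fin k]→L[ℝ] (𝔤 × 𝔤) :=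
  -hodge (g y) k (delbar ad a (fun z => hodge (g z) (rdim E - (k + 1)) (φ z)) y)

/-- The formal adjoint `∂̄_a^* = -∗ ∂_a ∗` of `∂̄_a`, on `(k+1)`-forms. -/
def delbarStar (g : E → E →L[ℝ] E →L[ℝ] ℝ) (ad : 𝔤 →L[ℝ] 𝔤 →L[ℝ] 𝔤) (a : E → E →L[ℝ] 𝔤) {k : ℕ}
    (φ : E → E [⋀^Fin (k + 1)]→L[ℝ] (𝔤 × 𝔤)) (y : E) : E [⋀^Fin k]→L[ℝ] (𝔤 × 𝔤) :=
  -hodge (g y) k (del ad a (fun z => hodge (g z) (rdim E - (k + 1)) (φ z)) y)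

end LocalCalculus

/-! ### Kähler manifolds -/

section Kaehler

variable {E : Type*} [NormedAddCommGroup E] [NormedSpace ℂ E]
variable {M : Type*} [TopologicalSpace M] [ChartedSpace E M]

/-- A complex manifold is a smooth (indeed real-analytic) real manifold, with the same charts. -/
instance realManifold [IsManifold 𝓘(ℂ, E) ω M] : IsManifold 𝓘(ℝ, E) ω M := by
  refine isManifold_of_contDiffOn 𝓘(ℝ, E) ω M fun e e' he he' => ?_
  have h := (contDiffGroupoid ω 𝓘(ℂ, E)).compatible he he'
  rw [contDiffGroupoid, mem_groupoid_of_pregroupoid] at h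
  exact ContDiffOn.restrict_scalars ℝ h.1

variable [IsManifold 𝓘(ℂ, E) ω M]

/-- A Riemannian metric on the real manifold underlying `M`. -/
abbrev RMetric (E : Type*) [NormedAddCommGroup E] [NormedSpace ℂ E]
    (M : Type*) [TopologicalSpace M] [ChartedSpace E M] [IsManifold 𝓘(ℂ, E) ω M] :=
  Bundle.ContMDiffRiemannianMetric 𝓘(ℝ, E) ∞ E (fun x : M => TangentSpace 𝓘(ℝ, E) x)

/-- The metric in a chart: the pullback of `g` by the inverse of the chart `c`. -/
def localMetric (g : RMetric E M) (c : OpenPartialHomeomorph M E) (y : E) : E →L[ℝ] E →L[ℝ] ℝ :=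
  let D : E →L[ℝ] E := mfderiv 𝓘(ℝ, E) 𝓘(ℝ, E) c.symm y
  let γ : E →L[ℝ] E →L[ℝ] ℝ := g.inner (c.symm y)
  γ.bilinearComp D D

/-- `g` is a Kähler metric: in every holomorphic chart, it is invariant under the complex structure
and its fundamental form `ω(u, v) = g(J u, v)` is closed. -/
structure IsKaehler (g : RMetric E M) : Prop where
  hermitian : ∀ c ∈ IsManifold.maximalAtlas 𝓘(ℂ, E) ω M, ∀ y ∈ c.target, ∀ u v : E,
    localMetric g c y (J E u) (J E v) = localMetric g c y u v
  closed : ∀ c ∈ IsManifold.maximalAtlas 𝓘(ℂ, E) ω M, ∀ y ∈ c.target,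
    extDeriv (fun z => fundForm (localMetric g c z)) y = 0

end Kaehler

/-! ### Principal bundles and connections -/

section Principal

variable {E : Type*} [NormedAddCommGroup E] [NormedSpace ℂ E]
variable {M : Type*} [TopologicalSpace M] [ChartedSpace E M]
variable {EG : Type*} [NormedAddCommGroup EG] [NormedSpace ℝ EG]
variable {G : Type*} [TopologicalSpace G] [ChartedSpace EG G] [Group G]
variable {EP : Type*} [NormedAddCommGroup EP] [NormedSpace ℝ EP]
variable {P : Type*} [TopologicalSpace P] [ChartedSpace EP P] [MulAction Gᵐᵒᵖ P]

variable (E EG G EP) in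
/-- `π : P → M` is a smooth principal `G`-bundle; the right action `p · g` is `op g • p`. -/
structure IsPrincipalBundle (π : P → M) : Prop where
  smooth_action : ContMDiff (𝓘(ℝ, EP).prod 𝓘(ℝ, EG)) 𝓘(ℝ, EP) ∞
    (fun q : P × G => MulOpposite.op q.2 • q.1)
  locally_trivial : ∀ x : M, ∃ U : Set M, x ∈ U ∧
    ∃ Φ : PartialDiffeomorph (𝓘(ℝ, E).prod 𝓘(ℝ, EG)) 𝓘(ℝ, EP) (M × G) P ∞,
      Φ.source = U ×ˢ Set.univ ∧ Φ.target = π ⁻¹' U ∧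
      (∀ z ∈ U, ∀ h : G, π (Φ (z, h)) = z) ∧
      ∀ z ∈ U, ∀ h k : G, Φ (z, h * k) = MulOpposite.op k • Φ (z, h)

variable (EG) in
/-- The adjoint action `Ad g` on the Lie algebra: the derivative at `1` of `h ↦ g h g⁻¹`. -/
def Ad (g : G) : GroupLieAlgebra 𝓘(ℝ, EG) G →L[ℝ] GroupLieAlgebra 𝓘(ℝ, EG) G :=
  mfderiv 𝓘(ℝ, EG) 𝓘(ℝ, EG) (fun h : G => g * h * g⁻¹) 1

variable (EG G EP P) in
/-- A connection on a principal bundle with total space `P`: a smooth `𝔤`-valued `1`-form on `P`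
which is `Ad`-equivariant and reproduces the generators of the fundamental vector fields. -/
structure PrincipalConnection [IsManifold 𝓘(ℝ, EP) ∞ P] where
  form (p : P) : TangentSpace 𝓘(ℝ, EP) p →L[ℝ] GroupLieAlgebra 𝓘(ℝ, EG) G
  smooth : ContMDiff 𝓘(ℝ, EP).tangent 𝓘(ℝ, EG) (M' := EG) ∞
    (fun v : TangentBundle 𝓘(ℝ, EP) P => form v.1 v.2)
  equivariant : ∀ (p : P) (g : G) (v : TangentSpace 𝓘(ℝ, EP) p),
    form (MulOpposite.op g • p)
      (mfderiv 𝓘(ℝ, EP) 𝓘(ℝ, EP) (fun q : P => MulOpposite.op g • q) p v) =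
      Ad EG g⁻¹ (form p v)
  vertical : ∀ (p : P) (ξ : GroupLieAlgebra 𝓘(ℝ, EG) G),
    form p (mfderiv 𝓘(ℝ, EG) 𝓘(ℝ, EP) (fun g : G => MulOpposite.op g • p) 1 ξ) = ξ

variable (EG G) in
/-- The Lie bracket of the Lie algebra `𝔤 = T_1 G` (with underlying normed space `EG`), as a
continuous bilinear map: `lieAd x y = [x, y]`. -/
def lieAd [FiniteDimensional ℝ EG] [LieGroup 𝓘(ℝ, EG) ∞ G] : EG →L[ℝ] EG →L[ℝ] EG :=
  haveI : LieGroup 𝓘(ℝ, EG) (minSmoothness ℝ 3) G :=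
    LieGroup.of_le (n := ∞) (by rw [minSmoothness_of_isRCLikeNormedField]; exact WithTop.coe_le_coe.2 le_top)
  haveI : CompleteSpace EG := FiniteDimensional.complete ℝ EG
  LinearMap.toContinuousLinearMap
    { toFun := fun x => LinearMap.toContinuousLinearMap
        ((LieAlgebra.ad ℝ (GroupLieAlgebra 𝓘(ℝ, EG) G) x : Module.End ℝ _) : EG →ₗ[ℝ] EG)
      map_add' := fun x y => by ext z; exact add_lie (L := GroupLieAlgebra 𝓘(ℝ, EG) G) (M := GroupLieAlgebra 𝓘(ℝ, EG) G) x y z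
      map_smul' := fun r x => by ext z; exact smul_lie (L := GroupLieAlgebra 𝓘(ℝ, EG) G) (M := GroupLieAlgebra 𝓘(ℝ, EG) G) r x z }

variable (EP) in
/-- `σ` is a smooth section of `π : P → M` over the domain of the holomorphic chart `c`, written in
the coordinates of that chart. -/
structure IsLocalGauge (π : P → M) (c : OpenPartialHomeomorph M E) (σ : E → P) : Prop where
  chart : c ∈ IsManifold.maximalAtlas 𝓘(ℂ, E) ω M
  smooth : ContMDiffOn 𝓘(ℝ, E) 𝓘(ℝ, EP) ∞ σ c.target
  section_eq : ∀ y ∈ c.target, π (σ y) = c.symm y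

/-- The local connection form: the pullback `σ^* A` of the connection form by a local section, in the
coordinates of the chart. -/
def gaugePotential [IsManifold 𝓘(ℝ, EP) ∞ P] (A : PrincipalConnection EG G EP P) (σ : E → P)
    (y : E) : E →L[ℝ] EG :=
  let D : E →L[ℝ] EP := mfderiv 𝓘(ℝ, E) 𝓘(ℝ, EP) σ y
  let α : EP →L[ℝ] EG := A.form (σ y)
  α.comp D

section YangMills

variable [FiniteDimensional ℂ E] [IsManifold 𝓘(ℂ, E) ω M]
variable [FiniteDimensional ℝ EG] [LieGroup 𝓘(ℝ, EG) ∞ G] [IsManifold 𝓘(ℝ, EP) ∞ P]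

/-- The curvature `F_A` in a local gauge, a `𝔤`-valued `2`-form. -/
def curvature (A : PrincipalConnection EG G EP P) (σ : E → P) (y : E) : E [⋀^Fin 2]→L[ℝ] EG :=
  curv (lieAd EG G) (gaugePotential A σ) y

/-- `F_A^{2,0}` in a local gauge. -/
def curvature20 (A : PrincipalConnection EG G EP P) (σ : E → P) (y : E) :
    E [⋀^Fin 2]→L[ℝ] (EG × EG) :=
  part20 (complexify (curvature A σ y))

/-- `F_A^{0,2}` in a local gauge. -/
def curvature02 (A : PrincipalConnection EG G EP P) (σ : E → P) (y : E) :
    E [⋀^Fin 2]→L[ℝ] (EG × EG) :=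
  part02 (complexify (curvature A σ y))

/-- `F̂_A = Λ_ω F_A` in a local gauge and a chart, as a `𝔤 ⊗ ℂ`-valued `0`-form. -/
def curvatureHat (g : RMetric E M) (A : PrincipalConnection EG G EP P)
    (c : OpenPartialHomeomorph M E) (σ : E → P) (y : E) : E [⋀^Fin 0]→L[ℝ] (EG × EG) :=
  complexify (contractOmega (localMetric g c y) (curvature A σ y))

/-- `A` is a Yang–Mills connection: `d_A^* F_A = 0`.  A form with values in the adjoint bundle
vanishes if and only if it vanishes in all local gauges. -/
def IsYangMills (g : RMetric E M) (π : P → M) (A : PrincipalConnection EG G EP P) : Prop :=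
  ∀ (c : OpenPartialHomeomorph M E) (σ : E → P), IsLocalGauge EP π c σ → ∀ y ∈ c.target,
    dCovStar (localMetric g c) (lieAd EG G) (gaugePotential A σ) (curvature A σ) y = 0

end YangMills

end Principal

end KaehlerYM

end

/-! The identities are pointwise and local, so fix a holomorphic chart, a gauge and a point `y`. In
such a chart `J` is a constant matrix, while the metric `γ` varies. No Levi-Civita connection is
used: `∇` below is the coordinate derivative plus the gauge term `ad (a ·)`, and all metric
corrections come from differentiating `√g` and the inverse metric.

Expanding both Hodge stars (`neg_hodge_alternatize_apply`) turns the codifferential of a `2`-form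
`φ`, evaluated on `v`, into `-(1/√g) ∑_k ∇_{e_k} (√g φ(e^k, β^♯))`. Here `β = γ_y(v)` is a covector
frozen at `y` and raised with the metric at the moving point. Replacing `∇` by its `(1,0)`- or
`(0,1)`-part gives `∂̄_A^*` or `∂_A^*`. Up to the sign and the density, this sum is `covDiv`.

Let `H = F - F(J·, J·)`. Then `F^{0,2}` and `F^{2,0}` are `(1/4)(H ± √-1 H(J·, ·))`, so only
divergences of `H` matter. The Yang–Mills equation kills the divergence of `F`. The geometric core
is `covDiv_comp_J`: from the Bianchi identity and `dω = 0`, the divergence of `F(J·, J·)` at `v` is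
`-√g ∇_{Jv} F̂`. Its pointwise algebra is isolated in `div_comp_J_algebra`, where `dω = 0` enters
twice: once as a trace identity which cancels the derivative of `√g`, and once as the Jacobi
identity for `ω⁻¹`. Hence the divergence of `H` at `v` is `√g ∇_{Jv} F̂`.

Since `J` is constant, it can be moved between the direction of differentiation, the first slot and
the second slot (`covDiv_precompJ_J`, `covDiv_J`, `covDiv_precompJ`). This gives the divergence of
`H(J·, ·)`, and shows that the type projection of `∇` does not change the divergence
(`sum_typeProj`). Comparing real and imaginary parts with the projected derivative of `F̂` finishes
the proof (`codifferential_typePart`). A sign `ε = ±1` treats both types at once. -/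

noncomputable section

namespace KaehlerYM

/-! ### Contractions over dual frames and the pointwise Kähler algebra -/

section DualFrames

variable {E : Type*} [NormedAddCommGroup E] [NormedSpace ℝ E]
variable {W : Type*} [NormedAddCommGroup W] [NormedSpace ℝ W]
variable {ι : Type*} [Fintype ι]

/-- Two frames `e`, `x` which are dual with respect to the symmetric bilinear form `b`. -/
structure DualFrames (b : E →L[ℝ] E →L[ℝ] ℝ) (e x : ι → E) : Prop where
  symm : ∀ u v, b u v = b v u
  expand_right : ∀ u, ∑ k, b u (e k) • x k = u
  expand_left : ∀ u, ∑ k, b u (x k) • e k = u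

namespace DualFrames

variable {b : E →L[ℝ] E →L[ℝ] ℝ} {e x : ι → E}

/-- Both sides are the contraction of `T` with the inverse metric `b (x k) (x m)`, which is
symmetric. -/
theorem sum_swap (h : DualFrames b e x) (T : E →ₗ[ℝ] E →ₗ[ℝ] W) :
    ∑ k, T (e k) (x k) = ∑ k, T (x k) (e k) := by
  have h1 : ∀ k, T (e k) (x k) = ∑ m, b (x k) (x m) • T (e k) (e m) := fun k => by
    conv_lhs => rw [← h.expand_left (x k)]
    simp only [map_sum, map_smul]
  have h2 : ∀ k, T (x k) (e k) = ∑ m, b (x k) (x m) • T (e m) (e k) := fun k => by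
    conv_lhs => rw [← h.expand_left (x k)]
    simp only [map_sum, map_smul, LinearMap.sum_apply, LinearMap.smul_apply]
  simp only [h1, h2]
  rw [Finset.sum_comm]
  simp only [h.symm]

/-- Contraction with the inverse metric is invariant under the infinitesimal isometry `A`. It is
used with `A = J`, to carry `J` from one factor of a contraction to the other. -/
theorem sum_skew (h : DualFrames b e x) {A : E →L[ℝ] E} (hA : ∀ u v, b (A u) v = -b u (A v))
    (T : E →ₗ[ℝ] E →ₗ[ℝ] W) :
    ∑ k, T (e k) (A (x k)) = -∑ k, T (A (e k)) (x k) := by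
  have h1 : ∀ k, T (e k) (A (x k)) = ∑ m, b (A (x k)) (e m) • T (e k) (x m) := fun k => by
    conv_lhs => rw [← h.expand_right (A (x k))]
    simp only [map_sum, map_smul]
  have h2 : ∀ k, T (A (e k)) (x k) = ∑ m, b (A (e k)) (x m) • T (e m) (x k) := fun k => by
    conv_lhs => rw [← h.expand_left (A (e k))]
    simp only [map_sum, map_smul, LinearMap.sum_apply, LinearMap.smul_apply]
  simp only [h1, h2]
  rw [Finset.sum_comm, ← Finset.sum_neg_distrib]
  refine Finset.sum_congr rfl fun k _ => ?_
  rw [← Finset.sum_neg_distrib]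
  refine Finset.sum_congr rfl fun m _ => ?_
  rw [hA, h.symm, neg_smul]

theorem ext (h : DualFrames b e x) {u v : E} (huv : ∀ w, b u w = b v w) : u = v := by
  rw [← h.expand_right u, ← h.expand_right v]
  simp only [huv]

end DualFrames

/-- The algebra behind the Kähler identities: `b'` is the derivative of a metric `b` with closed
fundamental form, `Γ` is `b'` with an index raised, and `DF` satisfies the Bianchi identity. -/
theorem div_comp_J_algebra {b : E →L[ℝ] E →L[ℝ] ℝ} {e x : ι → E} (h : DualFrames b e x)
    {I : E →L[ℝ] E} (hI : ∀ u, I (I u) = -u) (hb : ∀ u v, b (I u) (I v) = b u v)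
    {b' : E →L[ℝ] E →L[ℝ] E →L[ℝ] ℝ} (hs' : ∀ u v w, b' u v w = b' u w v)
    (hI' : ∀ u v w, b' u (I v) (I w) = b' u v w)
    (hc : ∀ u v w, b' u (I v) w + b' v (I w) u + b' w (I u) v = 0)
    {Γ : E →L[ℝ] E →L[ℝ] E} (hΓ : ∀ u v w, b (Γ u v) w = b' u v w)
    {F : E →L[ℝ] E →L[ℝ] W} (hF : ∀ u v, F u v = -F v u)
    {DF : E →L[ℝ] E →L[ℝ] E →L[ℝ] W} (hDF : ∀ u v w, DF u v w = -DF u w v)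
    (hB : ∀ u v w, DF u v w + DF v w u + DF w u v = 0) (v : E) :
    ∑ k, ((1 / 2 * ∑ m, b' (e k) (e m) (x m)) • F (I (x k)) (I v) + DF (e k) (I (x k)) (I v)
        - F (I (Γ (e k) (x k))) (I v) - F (I (x k)) (I (Γ (e k) v)))
      = -((1 / 2 : ℝ) • ∑ k, (DF (I v) (e k) (I (x k)) - F (e k) (I (Γ (I v) (x k))))) := by
  have hskew : ∀ u v, b (I u) v = -b u (I v) := fun u v => by
    rw [← hb (I u) v, hI]; simp
  have hskew' : ∀ u v w, b' u (I v) w = -b' u v (I w) := fun u v w => by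
    rw [← hI' u (I v) w, hI]; simp
  -- the trace identity
  have tr : ∀ u, (1 / 2 : ℝ) * ∑ m, b' u (e m) (x m) = ∑ k, b' (e k) (x k) u := fun u => by
    have h0 : ∀ k, b' (e k) (x k) u - b' (I (x k)) (I u) (e k) - b' u (I (e k)) (I (x k)) = 0 :=
      fun k => by
        -- This choice of arguments cancels `I` in the first term of `hc`. After summation over `k`
        -- the first two terms contribute the same divergence-type trace, and the third is the trace
        -- of `b' u`.
        have := hc (e k) (-(I (x k))) u
        simp only [map_neg, hI, neg_neg, neg_apply] at this
        linarith
    have h1 : ∑ k, b' (I (x k)) (I u) (e k) = -∑ k, b' (e k) (x k) u := by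
      have := h.sum_skew hskew (LinearMap.mk₂ ℝ (fun p q => b' q (I u) p)
        (by intros; simp) (by intros; simp) (by intros; simp) (by intros; simp))
      simp only [LinearMap.mk₂_apply] at this
      rw [this]
      have h2 := h.sum_swap (LinearMap.mk₂ ℝ (fun p q => b' q (I u) (I p))
        (by intros; simp) (by intros; simp) (by intros; simp) (by intros; simp))
      simp only [LinearMap.mk₂_apply] at h2
      rw [h2]
      simp only [hI', hs' _ u]
    have h3 : ∑ k, (b' (e k) (x k) u - b' (I (x k)) (I u) (e k) - b' u (I (e k)) (I (x k))) = 0 :=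
      Finset.sum_eq_zero fun k _ => h0 k
    simp only [Finset.sum_sub_distrib, h1, hI'] at h3
    linarith
  -- The trace identity with its free index raised. The left side is the gradient of `log √g`, so
  -- the derivative of the density cancels the derivative of the inverse metric in the first slot of
  -- `F`.
  have trv : ∑ k, (1 / 2 * ∑ m, b' (e k) (e m) (x m)) • x k = ∑ k, Γ (e k) (x k) := by
    refine h.ext fun w => ?_
    simp only [map_sum, map_smul, sum_apply, smul_apply, hΓ,
      smul_eq_mul]
    rw [← tr]
    conv_rhs => rw [← h.expand_left w]
    simp only [map_sum, map_smul, sum_apply, smul_apply, smul_eq_mul]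
    rw [Finset.sum_comm, Finset.mul_sum]
    refine Finset.sum_congr rfl fun i _ => ?_
    rw [← Finset.mul_sum, h.symm w]
    ring
  have A1 : ∑ k, (1 / 2 * ∑ m, b' (e k) (e m) (x m)) • F (I (x k)) (I v)
      = ∑ k, F (I (Γ (e k) (x k))) (I v) := by
    have := congrArg (fun u => F (I u) (I v)) trv
    simpa only [map_sum, map_smul, sum_apply,
      smul_apply] using this
  -- the Bianchi identity
  have A2 : ∑ k, DF (e k) (I (x k)) (I v) = -((1 / 2 : ℝ) • ∑ k, DF (I v) (e k) (I (x k))) := by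
    -- After contraction two of the three Bianchi terms coincide; this produces the factor `1 / 2`.
    have h1 : ∑ k, DF (I (x k)) (I v) (e k) = ∑ k, DF (e k) (I (x k)) (I v) := by
      have := h.sum_skew hskew (LinearMap.mk₂ ℝ (fun p q => DF q (I v) p)
        (by intros; simp) (by intros; simp) (by intros; simp) (by intros; simp))
      simp only [LinearMap.mk₂_apply] at this
      rw [this]
      have h2 := h.sum_swap (LinearMap.mk₂ ℝ (fun p q => DF q (I v) (I p))
        (by intros; simp) (by intros; simp) (by intros; simp) (by intros; simp))
      simp only [LinearMap.mk₂_apply] at h2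
      rw [h2, ← Finset.sum_neg_distrib]
      exact Finset.sum_congr rfl fun k _ => by rw [hDF, neg_neg]
    have h3 : ∑ k, (DF (e k) (I (x k)) (I v) + DF (I (x k)) (I v) (e k)
        + DF (I v) (e k) (I (x k))) = 0 := Finset.sum_eq_zero fun k _ => hB _ _ _
    simp only [Finset.sum_add_distrib, h1] at h3
    rw [← two_smul ℝ] at h3
    rw [eq_neg_of_add_eq_zero_right h3]
    module
  -- the Jacobi identity of the inverse of the fundamental form
  have A3 : ∑ k, F (I (x k)) (I (Γ (e k) v))
      = -((1 / 2 : ℝ) • ∑ k, F (e k) (I (Γ (I v) (x k)))) := by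
    -- Both sums in the claim are expanded in the same components `F (x k) (x m)`, so that they can
    -- be compared coefficient by coefficient.
    have T1 : ∑ k, F (I (x k)) (I (Γ (e k) v))
        = ∑ k, ∑ m, b' (I (e k)) v (I (e m)) • F (x k) (x m) := by
      have h1 := h.sum_skew hskew (LinearMap.mk₂ ℝ (fun p q => F q (I (Γ p v)))
        (by intros; simp) (by intros; simp) (by intros; simp) (by intros; simp))
      simp only [LinearMap.mk₂_apply] at h1
      rw [h1, ← Finset.sum_neg_distrib]
      refine Finset.sum_congr rfl fun k _ => ?_
      conv_lhs => rw [← h.expand_right (I (Γ (I (e k)) v))]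
      simp only [map_sum, map_smul, map_neg, hskew, hΓ, neg_smul, Finset.sum_neg_distrib, neg_neg]
    have T2 : ∑ k, F (e k) (I (Γ (I v) (x k)))
        = -∑ k, ∑ m, b' (I v) (e k) (I (e m)) • F (x k) (x m) := by
      have h1 := h.sum_swap (LinearMap.mk₂ ℝ (fun p q => F p (I (Γ (I v) q)))
        (by intros; simp) (by intros; simp) (by intros; simp) (by intros; simp))
      simp only [LinearMap.mk₂_apply] at h1
      rw [h1, ← Finset.sum_neg_distrib]
      refine Finset.sum_congr rfl fun k _ => ?_
      conv_lhs => rw [← h.expand_right (I (Γ (I v) (e k)))]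
      simp only [map_sum, map_smul, map_neg, hskew, hΓ, neg_smul, Finset.sum_neg_distrib]
    have T1' : ∑ k, F (I (x k)) (I (Γ (e k) v))
        = -∑ k, ∑ m, b' (I (e m)) v (I (e k)) • F (x k) (x m) := by
      rw [T1, Finset.sum_comm, ← Finset.sum_neg_distrib]
      refine Finset.sum_congr rfl fun k _ => ?_
      rw [← Finset.sum_neg_distrib]
      refine Finset.sum_congr rfl fun m _ => ?_
      rw [hF, smul_neg]
    -- Closedness of the fundamental form on `I (e k)`, `I (e m)`, `I v`. The first two coefficients
    -- contribute equally, because `F` is skew (`T1` and `T1'`).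
    have key : ∀ k m, b' (I (e k)) v (I (e m)) - b' (I (e m)) v (I (e k))
        - b' (I v) (e k) (I (e m)) = 0 := fun k m => by
      have := hc (I (e k)) (I (e m)) (I v)
      simp only [hI, map_neg, neg_apply] at this
      have h2 := hskew' (I (e k)) (e m) v
      rw [hs' (I (e k)) v, h2]
      linarith
    have h4 : ∑ k, ∑ m, (b' (I (e k)) v (I (e m)) - b' (I (e m)) v (I (e k))
        - b' (I v) (e k) (I (e m))) • F (x k) (x m) = 0 :=
      Finset.sum_eq_zero fun k _ => Finset.sum_eq_zero fun m _ => by rw [key, zero_smul]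
    simp only [sub_smul, Finset.sum_sub_distrib] at h4
    rw [← T1, ← neg_neg (∑ k, ∑ m, b' (I (e m)) v (I (e k)) • F (x k) (x m)), ← T1',
      ← neg_neg (∑ k, ∑ m, b' (I v) (e k) (I (e m)) • F (x k) (x m)), ← T2] at h4
    have h5 : ∑ k, F (e k) (I (Γ (I v) (x k))) = -((2 : ℝ) • ∑ k, F (I (x k)) (I (Γ (e k) v))) := by
      rw [two_smul]
      refine eq_neg_of_add_eq_zero_left ?_
      rw [← h4]; abel
    rw [h5]; module
  simp only [Finset.sum_sub_distrib, Finset.sum_add_distrib, A1, A2, A3]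
  module

end DualFrames

/-! ### Euclidean metrics, reciprocal vectors and raising indices -/

section Metric

variable {E : Type*} [NormedAddCommGroup E] [NormedSpace ℂ E]

/-- `b` is a Euclidean metric on the real vector space underlying `E`. -/
structure IsMetric (b : E →L[ℝ] E →L[ℝ] ℝ) : Prop where
  symm : ∀ u v, b u v = b v u
  pos : ∀ u, u ≠ 0 → 0 < b u u

variable [FiniteDimensional ℂ E]

/-- The coordinates of the fixed real basis. -/
def rcoord (k : Fin (rdim E)) : E →L[ℝ] ℝ :=
  LinearMap.toContinuousLinearMap ((rbasis E).coord k)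

@[simp] theorem rcoord_apply (k : Fin (rdim E)) (u : E) : rcoord k u = (rbasis E).repr u k := rfl

/-- The inverse `E^* → E` of a metric `E → E^*`. -/
def sharp (b : E →L[ℝ] E →L[ℝ] ℝ) : (E →L[ℝ] ℝ) →L[ℝ] E := ContinuousLinearMap.inverse b

namespace IsMetric

variable {b : E →L[ℝ] E →L[ℝ] ℝ} (hb : IsMetric b)
include hb

theorem ext {u v : E} (h : ∀ k, b u (rbasis E k) = b v (rbasis E k)) : u = v := by
  have h1 : b u = b v := by
    have : (b u : E →ₗ[ℝ] ℝ) = b v := (rbasis E).ext h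
    ext w
    exact LinearMap.congr_fun this w
  by_contra hne
  have := hb.pos (u - v) (sub_ne_zero.2 hne)
  simp [h1] at this

theorem posDef_gram : (gram b).PosDef := by
  refine Matrix.PosDef.of_dotProduct_mulVec_pos ?_ fun {c} hc => ?_
  · ext i j
    simp [gram, hb.symm]
  · have h1 : star c ⬝ᵥ (gram b).mulVec c
        = b (∑ i, c i • rbasis E i) (∑ i, c i • rbasis E i) := by
      simp only [gram, dotProduct, Matrix.mulVec, map_sum, map_smul, sum_apply, smul_apply,
        Matrix.of_apply, Pi.star_apply, star_trivial, smul_eq_mul]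
      refine Finset.sum_congr rfl fun i _ => ?_
      rw [Finset.mul_sum, Finset.mul_sum]
      refine Finset.sum_congr rfl fun j _ => ?_
      rw [hb.symm (rbasis E i)]
      ring
    rw [h1]
    refine hb.pos _ fun h0 => hc ?_
    funext i
    have := congrArg (fun u => (rbasis E).repr u i) h0
    simpa [Finsupp.single_apply] using this

theorem det_gram_pos : 0 < (gram b).det := hb.posDef_gram.det_pos

theorem recip_apply (k m : Fin (rdim E)) :
    b (recip b k) (rbasis E m) = if k = m then 1 else 0 := by
  have h1 : b (recip b k) (rbasis E m) = ((gram b)⁻¹ * gram b) k m := by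
    simp [recip, gram, Matrix.mul_apply]
  rw [h1, Matrix.nonsing_inv_mul _ (isUnit_iff_ne_zero.2 hb.det_gram_pos.ne'), Matrix.one_apply]

theorem recip_apply_left (k : Fin (rdim E)) (u : E) : b (recip b k) u = (rbasis E).repr u k := by
  conv_lhs => rw [← (rbasis E).sum_repr u]
  simp only [map_sum, map_smul, hb.recip_apply, smul_eq_mul, mul_ite, mul_one, mul_zero,
    Finset.sum_ite_eq, Finset.mem_univ, if_true]

theorem dualFrames : DualFrames b (rbasis E) (recip b) where
  symm := hb.symm
  expand_right u := by
    refine hb.ext fun m => ?_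
    simp [hb.recip_apply]
  expand_left u := by
    conv_rhs => rw [← (rbasis E).sum_repr u]
    exact Finset.sum_congr rfl fun k _ => by rw [hb.symm, hb.recip_apply_left]

theorem isInvertible : b.IsInvertible := by
  refine ContinuousLinearMap.IsInvertible.of_inverse
    (g := ∑ k, (ContinuousLinearMap.apply ℝ ℝ (rbasis E k)).smulRight (recip b k)) ?_ ?_
  · ext α u
    simp only [ContinuousLinearMap.comp_apply, sum_apply, ContinuousLinearMap.smulRight_apply,
      ContinuousLinearMap.apply_apply, map_sum, map_smul, smul_apply, hb.recip_apply_left,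
      ContinuousLinearMap.id_apply]
    conv_rhs => rw [← (rbasis E).sum_repr u]
    simp only [map_sum, map_smul, smul_eq_mul, mul_comm]
  · ext u
    simp [hb.dualFrames.expand_right]

theorem apply_sharp (α : E →L[ℝ] ℝ) : b (sharp b α) = α :=
  hb.isInvertible.self_apply_inverse α

theorem sharp_apply (u : E) : sharp b (b u) = u :=
  hb.isInvertible.inverse_apply_self u

theorem sharp_rcoord (k : Fin (rdim E)) : sharp b (rcoord k) = recip b k :=
  hb.ext fun m => by rw [hb.apply_sharp, hb.recip_apply_left, rcoord_apply]

end IsMetric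

end Metric

/-! ### Wedge products with forms of top degree -/

section Wedge

variable {E : Type*} [NormedAddCommGroup E] [NormedSpace ℝ E]
variable {W : Type*} [NormedAddCommGroup W] [NormedSpace ℝ W]

/-- The map `w ↦ η ⊗ w` from vectors to vector-valued forms. -/
def tensorForm {k : ℕ} (η : E [⋀^Fin k]→L[ℝ] ℝ) : W →L[ℝ] E [⋀^Fin k]→L[ℝ] W :=
  ((ContinuousLinearMap.compContinuousAlternatingMapCLM ℝ E ℝ W (Fin k)).flip η).comp
    (ContinuousLinearMap.toSpanSingletonCLE (𝕜 := ℝ) (E := W) : W →L[ℝ] ℝ →L[ℝ] W)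

theorem tensorForm_eq {k : ℕ} (η : E [⋀^Fin k]→L[ℝ] ℝ) (w : W) : tensorForm η w =
    (ContinuousLinearMap.toSpanSingleton ℝ w).compContinuousAlternatingMap η := rfl

@[simp] theorem tensorForm_apply {k : ℕ} (η : E [⋀^Fin k]→L[ℝ] ℝ) (w : W) (v : Fin k → E) :
    tensorForm η w v = η v • w := by
  simp [tensorForm_eq]

/-- The wedge product of a vector-valued linear form with a real form. -/
def wedge {k : ℕ} (l : E →L[ℝ] W) (η : E [⋀^Fin k]→L[ℝ] ℝ) : E [⋀^Fin (k + 1)]→L[ℝ] W :=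
  .alternatizeUncurryFin ((tensorForm η).comp l)

theorem wedge_apply {k : ℕ} (l : E →L[ℝ] W) (η : E [⋀^Fin k]→L[ℝ] ℝ) (v : Fin (k + 1) → E) :
    wedge l η v = ∑ i : Fin (k + 1), (-1 : ℤ) ^ (i : ℕ) • η (i.removeNth v) • l (v i) := by
  simp [wedge, ContinuousAlternatingMap.alternatizeUncurryFin_apply]

/-- The antiderivation rule for the interior product: the summand in which `l` takes the slot `0` is
split off, and the shift of the other slots gives the sign. -/
theorem curryLeft_wedge {k : ℕ} (l : E →L[ℝ] W) (η : E [⋀^Fin (k + 1)]→L[ℝ] ℝ) (u : E) :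
    (wedge l η).curryLeft u = tensorForm η (l u) - wedge l (η.curryLeft u) := by
  ext v
  rw [ContinuousAlternatingMap.curryLeft_apply_apply, wedge_apply, Fin.sum_univ_succ,
    ContinuousAlternatingMap.sub_apply, wedge_apply, tensorForm_apply, sub_eq_add_neg,
    ← Finset.sum_neg_distrib]
  congr 1
  · simp
  · refine Finset.sum_congr rfl fun i _ => ?_
    have h1 : i.succ.removeNth (Matrix.vecCons u v) = Matrix.vecCons u (i.removeNth v) := by
      ext j
      refine Fin.cases ?_ (fun j => ?_) j <;> simp [Fin.removeNth]
    rw [h1]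
    simp [pow_succ]

theorem wedge_top [FiniteDimensional ℝ E] {k : ℕ} (hk : k = Module.finrank ℝ E) (l : E →L[ℝ] W)
    (η : E [⋀^Fin k]→L[ℝ] ℝ) : wedge l η = 0 := by
  ext v
  refine (wedge l η).toAlternatingMap.map_linearDependent v fun h => ?_
  have := h.fintype_card_le_finrank
  simp [hk] at this

/-- The interior product with `u` of `l ∧ η`, which vanishes because its degree exceeds the
dimension. Contracting once more gives the next lemma. -/
theorem wedge_curryLeft_top [FiniteDimensional ℝ E] {k : ℕ} (hk : k + 1 = Module.finrank ℝ E)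
    (l : E →L[ℝ] W) (η : E [⋀^Fin (k + 1)]→L[ℝ] ℝ) (u : E) :
    wedge l (η.curryLeft u) = tensorForm η (l u) := by
  have h := curryLeft_wedge l η u
  rw [wedge_top hk] at h
  exact (sub_eq_zero.1 h.symm).symm

theorem wedge_curryLeft_curryLeft_top [FiniteDimensional ℝ E] {k : ℕ}
    (hk : k + 2 = Module.finrank ℝ E) (l : E →L[ℝ] W) (η : E [⋀^Fin (k + 2)]→L[ℝ] ℝ) (u w : E) :
    wedge l ((η.curryLeft u).curryLeft w)
      = tensorForm (η.curryLeft u) (l w) - tensorForm (η.curryLeft w) (l u) := by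
  have h := curryLeft_wedge l (η.curryLeft u) w
  rw [wedge_curryLeft_top hk] at h
  have h2 : (tensorForm η (l u)).curryLeft w = tensorForm (η.curryLeft w) (l u) := rfl
  rw [← h2, h]
  abel

end Wedge

/-! ### Sums of products of determinants over index tuples -/

section Count

/-- The injective completions of `p` are exactly the permutations of the `n` remaining indices,
transported by `p.succAbove`. -/
theorem card_injective_cons {n : ℕ} (p : Fin (n + 1)) :
    (Finset.univ.filter fun i : Fin n → Fin (n + 1) =>
      Function.Injective (Fin.cons p i : Fin (n + 1) → Fin (n + 1))).card = n.factorial := by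
  have h : (Finset.univ.filter fun i : Fin n → Fin (n + 1) =>
      Function.Injective (Fin.cons p i : Fin (n + 1) → Fin (n + 1)))
      = Finset.univ.image fun τ : Equiv.Perm (Fin n) => p.succAbove ∘ τ := by
    ext i
    simp only [Finset.mem_filter, Finset.mem_univ, true_and, Finset.mem_image,
      Fin.cons_injective_iff]
    constructor
    · rintro ⟨hp, hi⟩
      have : ∀ j, ∃ t, p.succAbove t = i j := fun j =>
        Fin.exists_succAbove_eq fun h => hp ⟨j, h⟩
      choose t ht using this
      have hinj : Function.Injective t := fun a b hab => hi (by rw [← ht, ← ht, hab])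
      exact ⟨Equiv.ofBijective t (Finite.injective_iff_bijective.1 hinj), funext ht⟩
    · rintro ⟨τ, rfl⟩
      refine ⟨fun ⟨j, hj⟩ => Fin.succAbove_ne _ _ hj, ?_⟩
      exact Fin.succAbove_right_injective.comp τ.injective
  rw [h, Finset.card_image_of_injective, Finset.card_univ, Fintype.card_perm, Fintype.card_fin]
  intro σ τ hστ
  ext j
  exact congrArg Fin.val (Fin.succAbove_right_injective (congrFun hστ j))

variable {E : Type*} [AddCommGroup E] [Module ℝ E]

/-- A product is nonzero only if `i` completes both `p` and `q` to a permutation. This forces `p =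
q`, and then the product is the square of a sign. -/
theorem sum_det_cons_mul_det_cons {n : ℕ} (B : Module.Basis (Fin (n + 1)) ℝ E)
    (p q : Fin (n + 1)) :
    ∑ i : Fin n → Fin (n + 1), B.det (Fin.cons (B p) (B ∘ i)) * B.det (Fin.cons (B q) (B ∘ i))
      = if p = q then (n.factorial : ℝ) else 0 := by
  have hc : ∀ (r : Fin (n + 1)) (i : Fin n → Fin (n + 1)),
      (Fin.cons (B r) (B ∘ i) : Fin (n + 1) → E) = B ∘ (Fin.cons r i) := fun r i => by
    funext j
    refine Fin.cases ?_ (fun j => ?_) j <;> simp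
  have h0 : ∀ σ : Fin (n + 1) → Fin (n + 1), ¬Function.Injective σ → B.det (B ∘ σ) = 0 :=
    fun σ hσ => B.det.map_eq_zero_of_not_injective _ fun h => hσ (Function.Injective.of_comp h)
  have h1 : ∀ σ : Fin (n + 1) → Fin (n + 1), Function.Injective σ →
      B.det (B ∘ σ) * B.det (B ∘ σ) = 1 := fun σ hσ => by
    obtain ⟨τ, rfl⟩ : ∃ τ : Equiv.Perm (Fin (n + 1)), σ = τ :=
      ⟨Equiv.ofBijective σ (Finite.injective_iff_bijective.1 hσ), rfl⟩
    rw [B.det.map_perm, B.det_self]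
    rcases Int.units_eq_one_or (Equiv.Perm.sign τ) with h | h <;> simp [h]
  simp only [hc]
  split_ifs with hpq
  · subst hpq
    have : ∀ i : Fin n → Fin (n + 1), B.det (B ∘ (Fin.cons p i)) * B.det (B ∘ (Fin.cons p i))
        = if Function.Injective (Fin.cons p i : Fin (n + 1) → Fin (n + 1)) then (1 : ℝ) else 0 :=
      fun i => by
        split_ifs with h
        · exact h1 _ h
        · rw [h0 _ h, zero_mul]
    simp only [this, Finset.sum_ite, Finset.sum_const_zero, add_zero, Finset.sum_const,
      nsmul_eq_mul, mul_one, card_injective_cons]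
  · refine Finset.sum_eq_zero fun i _ => ?_
    by_cases hp : Function.Injective (Fin.cons p i : Fin (n + 1) → Fin (n + 1))
    · by_cases hq : Function.Injective (Fin.cons q i : Fin (n + 1) → Fin (n + 1))
      · exfalso
        obtain ⟨j, hj⟩ := (Finite.injective_iff_surjective.1 hp) q
        revert hj
        refine Fin.cases (fun h => hpq (by simpa using h)) (fun j h => ?_) j
        exact (Fin.cons_injective_iff.1 hq).1 ⟨j, by simpa using h⟩
      · rw [h0 _ hq, mul_zero]
    · rw [h0 _ hp, zero_mul]

end Count

section InsertFirst

variable {E : Type*} [NormedAddCommGroup E] [NormedSpace ℂ E]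

theorem insertFirst_one_apply {k : ℕ} (a : Fin k → E) (α : E [⋀^Fin (1 + k)]→L[ℝ] ℝ)
    (v : Fin 1 → E) :
    insertFirst a α v
      = α (fun j => (Fin.snoc a (v 0) : Fin (k + 1) → E) (Fin.cast (Nat.add_comm 1 k) j)) := by
  induction k with
  | zero =>
    change α v = _
    congr 1
    funext j
    rw [Subsingleton.elim j 0]
    simp [Fin.snoc]
  | succ k ih =>
    change insertFirst (Fin.tail a) (α.curryLeft (a 0)) v = _
    rw [ih, ContinuousAlternatingMap.curryLeft_apply_apply]
    congr 1
    funext j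
    have h := Fin.cons_snoc_eq_snoc_cons (a 0) (Fin.tail a) (v 0)
    rw [Fin.cons_self_tail] at h
    rw [← h]
    refine Fin.cases ?_ (fun j => ?_) j
    · rfl
    · rfl

end InsertFirst

/-! ### The Hodge star on `2`-forms and on contractions of the volume form -/

section Hodge

variable {E : Type*} [NormedAddCommGroup E] [NormedSpace ℂ E] [FiniteDimensional ℂ E]
variable {W : Type*} [NormedAddCommGroup W] [NormedSpace ℝ W]

theorem finrank_real_eq_rdim : Module.finrank ℝ E = rdim E := by
  rw [Module.finrank_eq_card_basis (rbasis E), Fintype.card_fin]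

theorem detForm_cast {N N' : ℕ} (h : N = rdim E) (h' : N' = rdim E) (e : N = N')
    (v : Fin N' → E) : detForm h (fun j => v (Fin.cast e j)) = detForm h' v := by
  subst e
  rfl

/-- The reciprocal vectors are moved from the volume form to `φ` by `sum_swap` in each index. The
remaining forms are contractions of the constant determinant with constant vectors, so for a varying
metric only the coefficients have to be differentiated. -/
theorem hodge_two {b : E →L[ℝ] E →L[ℝ] ℝ} (hb : IsMetric b) {l : ℕ} (h : l + 2 = rdim E)
    (φ : E [⋀^Fin 2]→L[ℝ] W) :
    hodge b l φ = ∑ k, ∑ m,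
      tensorForm (((detForm h).curryLeft (rbasis E k)).curryLeft (rbasis E m))
        ((1 / 2 : ℝ) • Real.sqrt (gram b).det • φ ![recip b k, recip b m]) := by
  have h0 : hodge b l φ = (1 / 2 : ℝ) • ∑ i : Fin 2 → Fin (rdim E),
      tensorForm (((volForm b h).curryLeft (recip b (i 0))).curryLeft (recip b (i 1)))
        (φ fun j => rbasis E (i j)) := by
    rw [hodge, dif_pos h]
    rfl
  rw [h0]
  ext v
  set d : E → E → ℝ := fun u w => detForm h (Matrix.vecCons u (Matrix.vecCons w v)) with hd
  have hd1 : ∀ u w : E, ((detForm h).curryLeft u).curryLeft w v = d u w := fun u w => rfl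
  have hvol : ∀ u w : E, ((volForm b h).curryLeft u).curryLeft w v
      = Real.sqrt (gram b).det * d u w := fun u w => rfl
  simp only [ContinuousAlternatingMap.smul_apply, ContinuousAlternatingMap.sum_apply,
    tensorForm_apply, hd1, hvol]
  have hsum : ∑ i : Fin 2 → Fin (rdim E),
      (Real.sqrt (gram b).det * d (recip b (i 0)) (recip b (i 1))) • φ (fun j => rbasis E (i j))
      = ∑ k, ∑ m, (Real.sqrt (gram b).det * d (recip b k) (recip b m)) •
          φ ![rbasis E k, rbasis E m] := by
    rw [← (finTwoArrowEquiv (Fin (rdim E))).symm.sum_comp, Fintype.sum_prod_type]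
    refine Finset.sum_congr rfl fun k _ => Finset.sum_congr rfl fun m _ => ?_
    have : (fun j => rbasis E ((finTwoArrowEquiv (Fin (rdim E))).symm (k, m) j))
        = ![rbasis E k, rbasis E m] := by
      funext j; fin_cases j <;> rfl
    rw [this]
    rfl
  rw [hsum]
  -- bilinear versions
  have φv : ∀ u w : E, φ ![u, w] = φ.curryLeft u ![w] := fun u w => rfl
  have φa1 : ∀ u u' w : E, φ ![u + u', w] = φ ![u, w] + φ ![u', w] := fun u u' w => by
    simp only [φv, map_add]; rfl
  have φm1 : ∀ (c : ℝ) (u w : E), φ ![c • u, w] = c • φ ![u, w] := fun c u w => by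
    simp only [φv, map_smul]; rfl
  have φv2 : ∀ u w : E, φ ![u, w] = (φ.curryLeft u).curryLeft w ![] := fun u w => rfl
  have φa2 : ∀ u w w' : E, φ ![u, w + w'] = φ ![u, w] + φ ![u, w'] := fun u w w' => by
    simp only [φv2, map_add]; rfl
  have φm2 : ∀ (c : ℝ) (u w : E), φ ![u, c • w] = c • φ ![u, w] := fun c u w => by
    simp only [φv2, map_smul]; rfl
  have da1 : ∀ u u' w : E, d (u + u') w = d u w + d u' w := fun u u' w => by
    simp only [← hd1, map_add]; rfl
  have dm1 : ∀ (c : ℝ) (u w : E), d (c • u) w = c * d u w := fun c u w => by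
    simp only [← hd1, map_smul]; rfl
  have da2 : ∀ u w w' : E, d u (w + w') = d u w + d u w' := fun u w w' => by
    simp only [← hd1, map_add]; rfl
  have dm2 : ∀ (c : ℝ) (u w : E), d u (c • w) = c * d u w := fun c u w => by
    simp only [← hd1, map_smul]; rfl
  have s1 : ∀ m, ∑ k, d (recip b k) (recip b m) • φ ![rbasis E k, rbasis E m]
      = ∑ k, d (rbasis E k) (recip b m) • φ ![recip b k, rbasis E m] := fun m => by
    have := hb.dualFrames.sum_swap (LinearMap.mk₂ ℝ
      (fun u w => d w (recip b m) • φ ![u, rbasis E m])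
      (by intros; simp only [φa1, smul_add]) (by intros; simp only [φm1]; rw [smul_comm])
      (by intros; simp only [da1, add_smul]) (by intros; simp only [dm1, mul_smul]))
    simpa only [LinearMap.mk₂_apply] using this
  have s2 : ∀ k, ∑ m, d (rbasis E k) (recip b m) • φ ![recip b k, rbasis E m]
      = ∑ m, d (rbasis E k) (rbasis E m) • φ ![recip b k, recip b m] := fun k => by
    have := hb.dualFrames.sum_swap (LinearMap.mk₂ ℝ
      (fun u w => d (rbasis E k) w • φ ![recip b k, u])
      (by intros; simp only [φa2, smul_add]) (by intros; simp only [φm2]; rw [smul_comm])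
      (by intros; simp only [da2, add_smul]) (by intros; simp only [dm2, mul_smul]))
    simpa only [LinearMap.mk₂_apply] using this
  simp only [mul_smul, ← Finset.smul_sum]
  have s3 : ∑ k, ∑ m, d (recip b k) (recip b m) • φ ![rbasis E k, rbasis E m]
      = ∑ k, ∑ m, d (rbasis E k) (rbasis E m) • φ ![recip b k, recip b m] := by
    rw [Finset.sum_comm]
    simp only [s1]
    rw [Finset.sum_comm]
    simp only [s2]
  rw [s3]
  simp only [Finset.smul_sum]
  refine Finset.sum_congr rfl fun k _ => Finset.sum_congr rfl fun m _ => ?_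
  module

/-- The sum over all index tuples of products of determinants is a metric contraction. -/
theorem sum_detForm_mul_detForm_recip {b : E →L[ℝ] E →L[ℝ] ℝ} (hb : IsMetric b) {n : ℕ}
    (h : n + 1 = rdim E) (u v : E) :
    ∑ i : Fin n → Fin (rdim E), detForm h (Matrix.vecCons u fun j => rbasis E (i j))
        * detForm h (Matrix.vecCons v fun j => recip b (i j))
      = n.factorial * (gram b).det⁻¹ * b u v := by
  set B := (rbasis E).reindex (finCongr h.symm) with hB
  have hBdet : ∀ w : Fin (n + 1) → E, detForm h w = B.det w := fun w => rfl
  -- the map `e_a ↦ e^a`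
  set f : E →ₗ[ℝ] E := (rbasis E).constr ℝ (recip b) with hf
  have hfe : ∀ k, f (rbasis E k) = recip b k := fun k => (rbasis E).constr_basis ℝ _ k
  -- Writing the reciprocal vectors as images under `f` pulls out this single scalar and reduces the
  -- sum to one over the fixed basis.
  have hdet : LinearMap.det f = (gram b).det⁻¹ := by
    rw [← LinearMap.det_toMatrix (rbasis E)]
    have : LinearMap.toMatrix (rbasis E) (rbasis E) f = ((gram b)⁻¹).transpose := by
      ext i j
      rw [LinearMap.toMatrix_apply, hfe, recip]
      simp [Finsupp.single_apply]
    rw [this, Matrix.det_transpose, Matrix.det_nonsing_inv, Ring.inverse_eq_inv]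
  obtain ⟨v', rfl⟩ : ∃ v', f v' = v := by
    refine ⟨∑ k, b v (rbasis E k) • rbasis E k, ?_⟩
    simp only [map_sum, map_smul, hfe, hb.dualFrames.expand_right]
  have h1 : ∀ i : Fin n → Fin (rdim E), detForm h (Matrix.vecCons (f v') fun j => recip b (i j))
      = (gram b).det⁻¹ * detForm h (Matrix.vecCons v' fun j => rbasis E (i j)) := fun i => by
    rw [← hdet, hBdet, hBdet, ← B.det_comp f]
    congr 1
    funext j
    refine Fin.cases ?_ (fun j => ?_) j
    · rfl
    · exact (hfe _).symm
  simp only [h1]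
  -- both sides are bilinear in `u` and `v'`
  set L : E →ₗ[ℝ] E →ₗ[ℝ] ℝ := LinearMap.mk₂ ℝ (fun u w => ∑ i : Fin n → Fin (rdim E),
      (detForm h).curryLeft u (fun j => rbasis E (i j))
        * (detForm h).curryLeft w (fun j => rbasis E (i j)))
      (by intros; simp only [map_add, ContinuousAlternatingMap.add_apply, add_mul,
            Finset.sum_add_distrib])
      (by intros; simp only [map_smul, ContinuousAlternatingMap.smul_apply, smul_eq_mul, mul_assoc,
            Finset.mul_sum])
      (by intros; simp only [map_add, ContinuousAlternatingMap.add_apply, mul_add,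
            Finset.sum_add_distrib])
      (by intros; simp only [map_smul, ContinuousAlternatingMap.smul_apply, smul_eq_mul,
            mul_left_comm, Finset.mul_sum]) with hL
  have hR : L = LinearMap.mk₂ ℝ (fun u w => (n.factorial : ℝ) * b u (f w))
      (by intros; simp only [map_add, add_apply, mul_add])
      (by intros; simp only [map_smul, smul_apply, smul_eq_mul, mul_left_comm])
      (by intros; simp only [map_add, mul_add])
      (by intros; simp only [map_smul, smul_eq_mul, mul_left_comm]) := by
    refine (rbasis E).ext fun p => (rbasis E).ext fun q => ?_
    rw [hL, LinearMap.mk₂_apply, LinearMap.mk₂_apply, hfe, hb.symm, hb.recip_apply]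
    simp only [ContinuousAlternatingMap.curryLeft_apply_apply]
    have e1 := sum_det_cons_mul_det_cons B (Fin.cast h.symm p) (Fin.cast h.symm q)
    have hBk : ∀ j : Fin (n + 1), B j = rbasis E (Fin.cast h j) := fun j => by
      simp [hB]
    have e2 : ∀ r : Fin (rdim E), B (Fin.cast h.symm r) = rbasis E r := fun r => by
      rw [hBk]; rfl
    rw [e2, e2, ← (Equiv.arrowCongr (Equiv.refl (Fin n)) (finCongr h)).sum_comp] at *
    trans ∑ i : Fin n → Fin (n + 1),
      B.det (Fin.cons (rbasis E p) (B ∘ i)) * B.det (Fin.cons (rbasis E q) (B ∘ i))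
    · refine Finset.sum_congr rfl fun i _ => ?_
      have : (fun j => rbasis E ((Equiv.arrowCongr (Equiv.refl (Fin n)) (finCongr h)) i j))
          = B ∘ i := by
        funext j
        simp [hBk]
      rw [this]
      rfl
    · rw [e1]
      simp only [Fin.cast_inj, eq_comm (a := p), mul_ite, mul_one, mul_zero]
  have := congrArg (fun T : E →ₗ[ℝ] E →ₗ[ℝ] ℝ => T u v') hR
  simp only [hL, LinearMap.mk₂_apply, ContinuousAlternatingMap.curryLeft_apply_apply] at this
  rw [mul_right_comm, ← this, Finset.sum_mul]
  exact Finset.sum_congr rfl fun i _ => by ring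

/-- The star of `ι_u vol` is, up to sign, the metric dual of `u`. The determinant is `vol` divided
by `√g`, whence the inverse density. -/
theorem hodge_curryLeft_detForm {b : E →L[ℝ] E →L[ℝ] ℝ} (hb : IsMetric b) {l : ℕ}
    (h : l + 2 = rdim E) (u : E) (w : W) (v : Fin 1 → E) :
    hodge b 1 (tensorForm ((detForm h).curryLeft u) w) v
      = -((Real.sqrt (gram b).det)⁻¹ * b u (v 0)) • w := by
  have h' : 1 + (l + 1) = rdim E := by omega
  -- The free argument sits in the last slot and must pass `l + 1` others. As the real dimension is
  -- even, this gives the minus sign of the statement.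
  have hl : Odd (l + 1) := by
    have : l + 2 = Module.finrank ℂ E * 2 := h
    rw [Nat.odd_iff]; omega
  have hvol : ∀ i : Fin (l + 1) → Fin (rdim E),
      insertFirst (fun j => recip b (i j)) (volForm b h') v
      = -(Real.sqrt (gram b).det *
          detForm h (Matrix.vecCons (v 0) fun j => recip b (i j))) := fun i => by
    rw [insertFirst_one_apply]
    change Real.sqrt (gram b).det * detForm h' _ = _
    rw [detForm_cast h' h, ← Fin.insertNth_last', ContinuousAlternatingMap.map_insertNth,
      Fin.val_last, hl.neg_one_pow]
    simp
  rw [hodge, dif_pos h']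
  simp only [ContinuousAlternatingMap.smul_apply, ContinuousAlternatingMap.sum_apply,
    ← tensorForm_eq]
  simp only [tensorForm_apply, hvol, ContinuousAlternatingMap.curryLeft_apply_apply, smul_smul]
  rw [← Finset.sum_smul, smul_smul]
  congr 1
  have hsum := sum_detForm_mul_detForm_recip hb h u (v 0)
  have hdet := hb.det_gram_pos
  have hs : Real.sqrt (gram b).det ^ 2 = (gram b).det := Real.sq_sqrt hdet.le
  have hs0 : Real.sqrt (gram b).det ≠ 0 := (Real.sqrt_pos.2 hdet).ne'
  have e : ∑ i : Fin (l + 1) → Fin (rdim E), -(Real.sqrt (gram b).det *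
        detForm h (Matrix.vecCons (v 0) fun j => recip b (i j))) *
        detForm h (Matrix.vecCons u fun j => rbasis E (i j))
      = -Real.sqrt (gram b).det * ((l + 1).factorial * (gram b).det⁻¹ * b u (v 0)) := by
    rw [← hsum, Finset.mul_sum]
    exact Finset.sum_congr rfl fun i _ => by ring
  have hinv : (gram b).det⁻¹ = (Real.sqrt (gram b).det ^ 2)⁻¹ := by rw [hs]
  rw [e, hinv]
  have hfac : ((l + 1).factorial : ℝ) ≠ 0 := by positivity
  field_simp

end Hodge

/-! ### Derivatives of the determinant, the density and the inverse metric -/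

section DetDeriv

-- Factor out `G`: the polynomial `det (1 + t G⁻¹ H)` has linear coefficient `trace (G⁻¹ H)`.
open Polynomial in
theorem deriv_det_add_smul {n : ℕ} (G H : Matrix (Fin n) (Fin n) ℝ) (hG : G.det ≠ 0) :
    HasDerivAt (fun t : ℝ => (G + t • H).det) (G.det * (G⁻¹ * H).trace) 0 := by
  set p : ℝ[X] := Matrix.det (1 + (X : ℝ[X]) • (G⁻¹ * H).map C) with hp
  have h1 : ∀ t : ℝ, (G + t • H).det = G.det * p.eval t := fun t => by
    have h2 : p.eval t = (1 + t • (G⁻¹ * H)).det := by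
      rw [hp, ← Polynomial.coe_evalRingHom, RingHom.map_det]
      congr 1
      ext i j
      simp [Matrix.one_apply, apply_ite (Polynomial.eval t), -Matrix.map_mul]
      ring
    rw [h2, ← Matrix.det_mul, mul_add, mul_one, Matrix.mul_smul, ← mul_assoc,
      Matrix.mul_nonsing_inv _ (isUnit_iff_ne_zero.2 hG), one_mul]
  have h3 : HasDerivAt (fun t : ℝ => G.det * p.eval t) (G.det * (p.derivative.eval 0)) 0 :=
    (p.hasDerivAt 0).const_mul _
  rw [Matrix.derivative_det_one_add_X_smul] at h3
  simpa only [h1] using h3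

variable {E : Type*} [NormedAddCommGroup E] [NormedSpace ℝ E]

theorem differentiable_det {n : ℕ} :
    Differentiable ℝ fun c : Fin n → Fin n → ℝ => (Matrix.of c).det := by
  simp only [Matrix.det_apply, Matrix.of_apply]
  fun_prop

theorem fderiv_det {n : ℕ} {c : E → Fin n → Fin n → ℝ} {y : E} (hc : DifferentiableAt ℝ c y)
    (hdet : (Matrix.of (c y)).det ≠ 0) (u : E) :
    fderiv ℝ (fun z => (Matrix.of (c z)).det) y u
      = (Matrix.of (c y)).det * ((Matrix.of (c y))⁻¹ * Matrix.of (fderiv ℝ c y u)).trace := by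
  have h1 := (differentiable_det (n := n) (c y)).hasFDerivAt.comp y hc.hasFDerivAt
  have h2 : fderiv ℝ (fun z => (Matrix.of (c z)).det) y u
      = fderiv ℝ (fun c : Fin n → Fin n → ℝ => (Matrix.of c).det) (c y) (fderiv ℝ c y u) := by
    have := h1.fderiv
    rw [show (fun z => (Matrix.of (c z)).det)
      = (fun c : Fin n → Fin n → ℝ => (Matrix.of c).det) ∘ c from rfl, this]
    rfl
  rw [h2]
  set H := fderiv ℝ c y u
  have h3 : HasDerivAt (fun t : ℝ => c y + t • H) H 0 := by
    simpa using ((hasDerivAt_id (0 : ℝ)).smul_const H).const_add (c y)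
  have h4 : HasFDerivAt (fun c : Fin n → Fin n → ℝ => (Matrix.of c).det)
      (fderiv ℝ (fun c : Fin n → Fin n → ℝ => (Matrix.of c).det) (c y)) (c y + (0 : ℝ) • H) := by
    simpa using (differentiable_det (n := n) (c y)).hasFDerivAt
  have h5 := h4.comp_hasDerivAt (0 : ℝ) h3
  exact h5.unique (deriv_det_add_smul (Matrix.of (c y)) (Matrix.of H) hdet)

end DetDeriv

section MetricDeriv

variable {E : Type*} [NormedAddCommGroup E] [NormedSpace ℂ E] [FiniteDimensional ℂ E]
variable {γ : E → E →L[ℝ] E →L[ℝ] ℝ} {y : E}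

/-- The density `√det(g_{ab})` of a metric in the fixed basis. -/
def dens (b : E →L[ℝ] E →L[ℝ] ℝ) : ℝ := Real.sqrt (gram b).det

theorem IsMetric.dens_pos {b : E →L[ℝ] E →L[ℝ] ℝ} (hb : IsMetric b) : 0 < dens b :=
  Real.sqrt_pos.2 hb.det_gram_pos

theorem hasFDerivAt_gram_apply (hγ : DifferentiableAt ℝ γ y) :
    DifferentiableAt ℝ (fun z => (fun i j => γ z (rbasis E i) (rbasis E j))) y :=
  differentiableAt_pi.2 fun i => differentiableAt_pi.2 fun j => by fun_prop

theorem differentiableAt_det_gram (hγ : DifferentiableAt ℝ γ y) :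
    DifferentiableAt ℝ (fun z => (gram (γ z)).det) y :=
  (differentiable_det _).comp y (hasFDerivAt_gram_apply hγ)

theorem differentiableAt_dens (hb : IsMetric (γ y)) (hγ : DifferentiableAt ℝ γ y) :
    DifferentiableAt ℝ (fun z => dens (γ z)) y :=
  (differentiableAt_det_gram hγ).sqrt hb.det_gram_pos.ne'

theorem fderiv_det_gram (hb : IsMetric (γ y)) (hγ : DifferentiableAt ℝ γ y)
    (hs : ∀ u v w, fderiv ℝ γ y u v w = fderiv ℝ γ y u w v) (u : E) :
    fderiv ℝ (fun z => (gram (γ z)).det) y u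
      = (gram (γ y)).det * ∑ m, fderiv ℝ γ y u (rbasis E m) (recip (γ y) m) := by
  have h := fderiv_det (hasFDerivAt_gram_apply hγ) hb.det_gram_pos.ne' u
  refine h.trans ?_
  change (gram (γ y)).det * ((gram (γ y))⁻¹ * _).trace = _
  congr 1
  simp only [Matrix.trace, Matrix.diag_apply, Matrix.mul_apply, Matrix.of_apply]
  refine Finset.sum_congr rfl fun m _ => ?_
  rw [hs, recip]
  simp only [map_sum, map_smul, sum_apply, smul_apply, smul_eq_mul]
  refine Finset.sum_congr rfl fun k _ => ?_
  congr 1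
  rw [fderiv_pi (fun i => (differentiableAt_pi.1 (hasFDerivAt_gram_apply hγ)) i),
    ContinuousLinearMap.pi_apply,
    fderiv_pi (fun j => (differentiableAt_pi.1
      ((differentiableAt_pi.1 (hasFDerivAt_gram_apply hγ)) k)) j), ContinuousLinearMap.pi_apply]
  have h1 := ((hγ.hasFDerivAt.clm_apply (hasFDerivAt_const (rbasis E k) y)).clm_apply
    (hasFDerivAt_const (rbasis E m) y)).fderiv
  rw [h1]
  simp

theorem fderiv_dens (hb : IsMetric (γ y)) (hγ : DifferentiableAt ℝ γ y)
    (hs : ∀ u v w, fderiv ℝ γ y u v w = fderiv ℝ γ y u w v) (u : E) :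
    fderiv ℝ (fun z => dens (γ z)) y u
      = dens (γ y) * (1 / 2 * ∑ m, fderiv ℝ γ y u (rbasis E m) (recip (γ y) m)) := by
  have h1 := ((differentiableAt_det_gram hγ).hasFDerivAt.sqrt hb.det_gram_pos.ne').fderiv
  have h2 : dens (γ y) ^ 2 = (gram (γ y)).det := Real.sq_sqrt hb.det_gram_pos.le
  have h3 := hb.dens_pos
  have h4 := congrArg (fun T : E →L[ℝ] ℝ => T u) h1
  simp only [smul_apply, smul_eq_mul, fderiv_det_gram hb hγ hs] at h4
  refine h4.trans ?_
  change 1 / (2 * dens (γ y)) * _ = _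
  rw [← h2]
  field_simp

theorem differentiableAt_sharp (hb : IsMetric (γ y)) (hγ : DifferentiableAt ℝ γ y) :
    DifferentiableAt ℝ (fun z => sharp (γ z)) y :=
  ((hb.isInvertible.contDiffAt_map_inverse (n := 1)).differentiableAt (by norm_num)).comp y hγ

/-- Differentiate `γ z (sharp (γ z) β) = β`, whose right side is constant. -/
theorem fderiv_sharp_apply (hb : ∀ᶠ z in nhds y, IsMetric (γ z)) (hγ : DifferentiableAt ℝ γ y)
    (β : E →L[ℝ] ℝ) (u : E) :
    fderiv ℝ (fun z => sharp (γ z) β) y u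
      = -sharp (γ y) (fderiv ℝ γ y u (sharp (γ y) β)) := by
  have hby := hb.self_of_nhds
  have hd : DifferentiableAt ℝ (fun z => sharp (γ z) β) y :=
    (differentiableAt_sharp hby hγ).clm_apply (differentiableAt_const β)
  have h1 : (fun z => γ z (sharp (γ z) β)) =ᶠ[nhds y] fun _ => β :=
    hb.mono fun z hz => hz.apply_sharp β
  have h2 := (hγ.hasFDerivAt.clm_apply hd.hasFDerivAt).fderiv
  rw [h1.fderiv_eq] at h2
  have h3 := congrArg (fun T : E →L[ℝ] E →L[ℝ] ℝ => T u) h2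
  simp only [fderiv_fun_const, Pi.zero_apply, zero_apply, add_apply, ContinuousLinearMap.comp_apply,
    ContinuousLinearMap.flip_apply] at h3
  rw [← hby.sharp_apply (fderiv ℝ (fun z => sharp (γ z) β) y u), eq_neg_of_add_eq_zero_left h3.symm,
    map_neg]

end MetricDeriv

/-! ### Bilinear maps and covariant derivatives of functions -/

section BilForm

variable {E : Type*} [NormedAddCommGroup E] [NormedSpace ℝ E]
variable {W : Type*} [NormedAddCommGroup W] [NormedSpace ℝ W]

/-- An alternating `2`-form as a bilinear map. -/
def bilForm : (E [⋀^Fin 2]→L[ℝ] W) →L[ℝ] E →L[ℝ] E →L[ℝ] W :=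
  (ContinuousLinearMap.compL ℝ E (E [⋀^Fin 1]→L[ℝ] W) (E →L[ℝ] W)
    ((ContinuousAlternatingMap.ofSubsingletonLIE (𝕜 := ℝ) (E := E) (F := W)
      (0 : Fin 1)).symm.toContinuousLinearEquiv : (E [⋀^Fin 1]→L[ℝ] W) →L[ℝ] E →L[ℝ] W)).comp
    (ContinuousAlternatingMap.curryLeftLI (𝕜 := ℝ) (E := E) (F := W) (n := 1)).toContinuousLinearMap

@[simp] theorem bilForm_apply (φ : E [⋀^Fin 2]→L[ℝ] W) (u v : E) : bilForm φ u v = φ ![u, v] := by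
  change φ (Matrix.vecCons u fun _ => v) = _
  congr 1
  funext j; fin_cases j <;> rfl

theorem bilForm_swap (φ : E [⋀^Fin 2]→L[ℝ] W) (u v : E) : bilForm φ u v = -bilForm φ v u := by
  rw [bilForm_apply, bilForm_apply]
  have := φ.toAlternatingMap.map_swap ![v, u] (i := 0) (j := 1) (by decide)
  have e : ![v, u] ∘ Equiv.swap (0 : Fin 2) 1 = ![u, v] := by
    ext i; fin_cases i <;> simp
  rw [e] at this
  exact this

end BilForm

section CovFun

variable {E : Type*} [NormedAddCommGroup E] [NormedSpace ℝ E]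
variable {𝔤 : Type*} [NormedAddCommGroup 𝔤] [NormedSpace ℝ 𝔤]
variable {W : Type*} [NormedAddCommGroup W] [NormedSpace ℝ W]

/-- The covariant derivative `v ↦ ∂_v f + ρ(a(v)) f` of a vector-valued function. -/
def covFun (ρ : 𝔤 →L[ℝ] W →L[ℝ] W) (a : E → E →L[ℝ] 𝔤) (f : E → W) (y : E) : E →L[ℝ] W :=
  fderiv ℝ f y + (ρ.comp (a y)).flip (f y)

theorem covFun_apply (ρ : 𝔤 →L[ℝ] W →L[ℝ] W) (a : E → E →L[ℝ] 𝔤) (f : E → W) (y v : E) :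
    covFun ρ a f y v = fderiv ℝ f y v + ρ (a y v) (f y) := rfl

theorem covFun_congr (ρ : 𝔤 →L[ℝ] W →L[ℝ] W) (a : E → E →L[ℝ] 𝔤) {f f' : E → W} {y : E}
    (h : f =ᶠ[nhds y] f') : covFun ρ a f y = covFun ρ a f' y := by
  rw [covFun, covFun, h.fderiv_eq, h.self_of_nhds]

theorem covFun_sum {ι : Type*} (s : Finset ι) (ρ : 𝔤 →L[ℝ] W →L[ℝ] W) (a : E → E →L[ℝ] 𝔤)
    {f : ι → E → W} {y : E} (h : ∀ i ∈ s, DifferentiableAt ℝ (f i) y) :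
    covFun ρ a (fun z => ∑ i ∈ s, f i z) y = ∑ i ∈ s, covFun ρ a (f i) y := by
  ext u
  simp only [covFun_apply, sum_apply, Finset.sum_add_distrib, fderiv_fun_sum h, map_sum]

theorem covFun_const_smul (ρ : 𝔤 →L[ℝ] W →L[ℝ] W) (a : E → E →L[ℝ] 𝔤) {f : E → W} {y : E}
    (h : DifferentiableAt ℝ f y) (c : ℝ) :
    covFun ρ a (fun z => c • f z) y = c • covFun ρ a f y := by
  ext u
  simp only [covFun_apply, smul_apply, fderiv_fun_const_smul h, map_smul, smul_add]

end CovFun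

/-! ### The codifferential of a `2`-form as a divergence -/

section Codifferential

variable {E : Type*} [NormedAddCommGroup E] [NormedSpace ℂ E] [FiniteDimensional ℂ E]
variable {𝔤 : Type*} [NormedAddCommGroup 𝔤] [NormedSpace ℝ 𝔤]
variable {W : Type*} [NormedAddCommGroup W] [NormedSpace ℝ W]

theorem covDeriv_apply (ρ : 𝔤 →L[ℝ] W →L[ℝ] W) (a : E → E →L[ℝ] 𝔤) {k : ℕ}
    (φ : E → E [⋀^Fin k]→L[ℝ] W) (y u : E) :
    covDeriv ρ a φ y u = fderiv ℝ φ y u + (ρ (a y u)).compContinuousAlternatingMap (φ y) := rfl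

theorem covDeriv_congr (ρ : 𝔤 →L[ℝ] W →L[ℝ] W) (a : E → E →L[ℝ] 𝔤) {k : ℕ}
    {φ φ' : E → E [⋀^Fin k]→L[ℝ] W} {y : E} (h : φ =ᶠ[nhds y] φ') :
    covDeriv ρ a φ y = covDeriv ρ a φ' y := by
  rw [covDeriv, covDeriv, h.fderiv_eq, h.self_of_nhds]

/-- The forms `η i` do not depend on the point, so only the coefficients are differentiated. This is
how the expansion of `hodge_two` is used. -/
theorem covDeriv_sum_tensorForm {ι : Type*} [Fintype ι] (ρ : 𝔤 →L[ℝ] W →L[ℝ] W)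
    (a : E → E →L[ℝ] 𝔤) {k : ℕ} (η : ι → E [⋀^Fin k]→L[ℝ] ℝ) {f : ι → E → W} {y : E}
    (h : ∀ i, DifferentiableAt ℝ (f i) y) :
    covDeriv ρ a (fun z => ∑ i, tensorForm (η i) (f i z)) y
      = ∑ i, (tensorForm (η i)).comp (covFun ρ a (f i) y) := by
  have h1 : HasFDerivAt (fun z => ∑ i, tensorForm (η i) (f i z))
      (∑ i, (tensorForm (η i)).comp (fderiv ℝ (f i) y)) y := by
    refine HasFDerivAt.fun_sum fun i _ => ?_
    exact (tensorForm (η i)).hasFDerivAt.comp y (h i).hasFDerivAt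
  ext u v
  rw [covDeriv_apply, h1.fderiv]
  simp [covFun_apply, Finset.sum_add_distrib]

/-- The components, with raised indices and multiplied by the Riemannian density, of a bilinear
map: these are the functions whose divergence is the codifferential. -/
def field (γ : E → E →L[ℝ] E →L[ℝ] ℝ) (Z : E → E →L[ℝ] E →L[ℝ] W) (α β : E →L[ℝ] ℝ) (z : E) : W :=
  dens (γ z) • Z z (sharp (γ z) α) (sharp (γ z) β)

variable {γ : E → E →L[ℝ] E →L[ℝ] ℝ} {y : E}

theorem differentiableAt_field (hb : IsMetric (γ y)) (hγ : DifferentiableAt ℝ γ y)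
    {Z : E → E →L[ℝ] E →L[ℝ] W} (hZ : DifferentiableAt ℝ Z y) (α β : E →L[ℝ] ℝ) :
    DifferentiableAt ℝ (field γ Z α β) y := by
  have h1 := differentiableAt_dens hb hγ
  have h2 := differentiableAt_sharp hb hγ
  exact h1.smul ((hZ.clm_apply (h2.clm_apply (differentiableAt_const α))).clm_apply
    (h2.clm_apply (differentiableAt_const β)))

theorem field_comp_sum {Z : E → E →L[ℝ] E →L[ℝ] W} (α β : E →L[ℝ] ℝ) (z : E) :
    field γ Z α β z = ∑ m, β (rbasis E m) • field γ Z α (rcoord m) z := by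
  have h : β = ∑ m, β (rbasis E m) • rcoord m := by
    ext u
    conv_lhs => rw [← (rbasis E).sum_repr u]
    simp only [map_sum, map_smul, sum_apply, smul_apply, rcoord_apply, smul_eq_mul, mul_comm]
  conv_lhs => rw [h]
  simp only [field, map_sum, map_smul, Finset.smul_sum]
  exact Finset.sum_congr rfl fun m _ => smul_comm _ _ _

/-- Each wedge with a doubly contracted top form splits into two singly contracted ones. Their
totals agree because `D` is skew; the resulting factor `2` later cancels the `1 / 2` of `hodge_two`.
-/
theorem hodge_sum_wedge {b : E →L[ℝ] E →L[ℝ] ℝ} (hb : IsMetric b) {l : ℕ} (h : l + 2 = rdim E)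
    (D : Fin (rdim E) → Fin (rdim E) → E →L[ℝ] W) (hD : ∀ k m, D m k = -D k m) (v : Fin 1 → E) :
    hodge b 1 (∑ k, ∑ m, wedge (D k m)
        (((detForm h).curryLeft (rbasis E k)).curryLeft (rbasis E m))) v
      = (2 : ℝ) • (dens b)⁻¹ • ∑ k, ∑ m, b (rbasis E m) (v 0) • D k m (rbasis E k) := by
  have hlin : ∀ (s : Finset (Fin (rdim E) × Fin (rdim E)))
      (ψ : Fin (rdim E) × Fin (rdim E) → E [⋀^Fin (l + 1)]→L[ℝ] W),
      hodge b 1 (∑ i ∈ s, ψ i) v = ∑ i ∈ s, hodge b 1 (ψ i) v := fun s ψ => by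
    have h' : 1 + (l + 1) = rdim E := by omega
    simp only [hodge, dif_pos h', ContinuousAlternatingMap.smul_apply,
      ContinuousAlternatingMap.sum_apply, ← tensorForm_eq, map_sum]
    rw [Finset.sum_comm, Finset.smul_sum]
  have hsub : ∀ ψ ψ' : E [⋀^Fin (l + 1)]→L[ℝ] W,
      hodge b 1 (ψ - ψ') v = hodge b 1 ψ v - hodge b 1 ψ' v := fun ψ ψ' => by
    have h' : 1 + (l + 1) = rdim E := by omega
    simp only [hodge, dif_pos h', ContinuousAlternatingMap.smul_apply,
      ContinuousAlternatingMap.sum_apply, ContinuousAlternatingMap.sub_apply, ← tensorForm_eq,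
      map_sub, Finset.sum_sub_distrib, smul_sub]
  have hf : l + 2 = Module.finrank ℝ E := h.trans finrank_real_eq_rdim.symm
  rw [← Fintype.sum_prod_type', hlin]
  simp only [wedge_curryLeft_curryLeft_top hf, hsub, hodge_curryLeft_detForm hb h]
  rw [Fintype.sum_prod_type, Finset.sum_congr rfl fun k _ => Finset.sum_sub_distrib _ _,
    Finset.sum_sub_distrib]
  have h1 : ∑ k, ∑ m, -((Real.sqrt (gram b).det)⁻¹ * b (rbasis E k) (v 0)) •
      D k m (rbasis E m)
      = ∑ k, ∑ m, ((Real.sqrt (gram b).det)⁻¹ * b (rbasis E m) (v 0)) • D k m (rbasis E k) := by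
    rw [Finset.sum_comm]
    refine Finset.sum_congr rfl fun k _ => Finset.sum_congr rfl fun m _ => ?_
    rw [hD k m, neg_apply, neg_smul_neg]
  rw [h1]
  simp only [neg_smul, Finset.sum_neg_distrib, sub_neg_eq_add, ← two_smul ℝ, mul_smul,
    ← Finset.smul_sum]
  rfl

end Codifferential

section Codifferential

variable {E : Type*} [NormedAddCommGroup E] [NormedSpace ℂ E] [FiniteDimensional ℂ E]
variable {𝔤 : Type*} [NormedAddCommGroup 𝔤] [NormedSpace ℝ 𝔤]
variable {W : Type*} [NormedAddCommGroup W] [NormedSpace ℝ W]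

variable {γ : E → E →L[ℝ] E →L[ℝ] ℝ} {y : E}

/-- The codifferential of a `2`-form in coordinates.  The operator `T` selects the full covariant
derivative or one of its parts by type. -/
theorem neg_hodge_alternatize_apply (hb : ∀ᶠ z in nhds y, IsMetric (γ z))
    (hγ : DifferentiableAt ℝ γ y) (ρ : 𝔤 →L[ℝ] W →L[ℝ] W) (a : E → E →L[ℝ] 𝔤)
    {φ : E → E [⋀^Fin 2]→L[ℝ] W} (hφ : DifferentiableAt ℝ (fun z => bilForm (φ z)) y)
    {l : ℕ} (h : l + 2 = rdim E)
    (T : (E →L[ℝ] W) →ₗ[ℝ] (E →L[ℝ] W))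
    (T' : (E →L[ℝ] E [⋀^Fin l]→L[ℝ] W) →ₗ[ℝ] (E →L[ℝ] E [⋀^Fin l]→L[ℝ] W))
    (hT : ∀ (η : E [⋀^Fin l]→L[ℝ] ℝ) (D : E →L[ℝ] W),
      T' ((tensorForm η).comp D) = (tensorForm η).comp (T D)) (v : Fin 1 → E) :
    -hodge (γ y) 1 (.alternatizeUncurryFin
        (T' (covDeriv ρ a (fun z => hodge (γ z) l (φ z)) y))) v
      = -((dens (γ y))⁻¹ • ∑ k,
          T (covFun ρ a (field γ (fun z => bilForm (φ z)) (rcoord k) (γ y (v 0))) y)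
            (rbasis E k)) := by
  have hby := hb.self_of_nhds
  set fld := fun k m => field γ (fun z => bilForm (φ z)) (rcoord k) (rcoord m) with hfld
  have hfield : ∀ k m, DifferentiableAt ℝ (fld k m) y := fun k m =>
    differentiableAt_field hby hγ hφ (rcoord k) (rcoord m)
  -- The inner star has to be expanded on a neighbourhood, since it is going to be differentiated;
  -- the outer one is needed only at `y`.
  have h1 : (fun z => hodge (γ z) l (φ z)) =ᶠ[nhds y]
      fun z => ∑ p : Fin (rdim E) × Fin (rdim E),
        tensorForm (((detForm h).curryLeft (rbasis E p.1)).curryLeft (rbasis E p.2))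
          ((1 / 2 : ℝ) • fld p.1 p.2 z) := by
    filter_upwards [hb] with z hz
    rw [hodge_two hz h, Fintype.sum_prod_type]
    simp only [hfld, field, hz.sharp_rcoord, bilForm_apply]
    rfl
  have h4 := covDeriv_sum_tensorForm ρ a (ι := Fin (rdim E) × Fin (rdim E)) (y := y)
    (fun p => ((detForm h).curryLeft (rbasis E p.1)).curryLeft (rbasis E p.2))
    (f := fun p z => (1 / 2 : ℝ) • fld p.1 p.2 z)
    (fun p => (hfield p.1 p.2).fun_const_smul (1 / 2 : ℝ))
  rw [covDeriv_congr ρ a h1, h4, map_sum]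
  simp only [hT]
  rw [← ContinuousAlternatingMap.alternatizeUncurryFinCLM_apply, map_sum]
  simp only [ContinuousAlternatingMap.alternatizeUncurryFinCLM_apply]
  have h2 : ∀ p : Fin (rdim E) × Fin (rdim E), ContinuousAlternatingMap.alternatizeUncurryFin
      ((tensorForm (((detForm h).curryLeft (rbasis E p.1)).curryLeft (rbasis E p.2))).comp
        (T (covFun ρ a (fun z => (1 / 2 : ℝ) • fld p.1 p.2 z) y)))
      = wedge ((1 / 2 : ℝ) • T (covFun ρ a (fld p.1 p.2) y))
        (((detForm h).curryLeft (rbasis E p.1)).curryLeft (rbasis E p.2)) := fun p => by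
    rw [wedge, covFun_const_smul ρ a (hfield p.1 p.2), map_smul]
  have hanti : ∀ k m, fld m k = fun z => (-1 : ℝ) • fld k m z := fun k m => by
    funext z
    simp only [hfld, field]
    rw [bilForm_swap]
    module
  simp only [h2]
  rw [Fintype.sum_prod_type, hodge_sum_wedge hby h]
  · congr 1
    rw [smul_comm, Finset.smul_sum]
    congr 1
    refine Finset.sum_congr rfl fun k _ => ?_
    -- The covector `γ y (v 0)` is constant in `z`, so its components pass through the derivative
    -- and the sum over `m` collapses to one field.
    have h3 : field γ (fun z => bilForm (φ z)) (rcoord k) (γ y (v 0))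
        = fun z => ∑ m, (γ y (v 0) (rbasis E m)) • fld k m z :=
      funext fun z => field_comp_sum _ _ z
    have h5 := covFun_sum Finset.univ ρ a (y := y)
      (f := fun m z => (γ y (v 0) (rbasis E m)) • fld k m z)
      (fun m _ => (hfield k m).fun_const_smul _)
    rw [h3, h5]
    simp only [covFun_const_smul ρ a (hfield k _), map_sum, map_smul, sum_apply, smul_apply,
      Finset.smul_sum]
    refine Finset.sum_congr rfl fun m _ => ?_
    rw [hby.symm]
    module
  · intro k m
    rw [hanti k m, covFun_const_smul ρ a (hfield k m), map_smul]
    module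

end Codifferential

/-! ### The curvature as a bilinear map and the Bianchi identity -/

section Bianchi

variable {E : Type*} [NormedAddCommGroup E] [NormedSpace ℝ E]
variable {𝔤 : Type*} [NormedAddCommGroup 𝔤] [NormedSpace ℝ 𝔤]

/-- The curvature `∂_u a(v) - ∂_v a(u) + [a(u), a(v)]` as a bilinear map. -/
def curvBil (ad : 𝔤 →L[ℝ] 𝔤 →L[ℝ] 𝔤) (a : E → E →L[ℝ] 𝔤) (y : E) : E →L[ℝ] E →L[ℝ] 𝔤 :=
  fderiv ℝ a y - (fderiv ℝ a y).flip + ad.bilinearComp (a y) (a y)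

theorem differentiableAt_flip {V W : Type*} [NormedAddCommGroup V] [NormedSpace ℝ V]
    [NormedAddCommGroup W] [NormedSpace ℝ W] {f : E → V →L[ℝ] W →L[ℝ] 𝔤} {y : E}
    (hf : DifferentiableAt ℝ f y) : DifferentiableAt ℝ (fun z => (f z).flip) y := by
  have h : Differentiable ℝ (fun B : V →L[ℝ] W →L[ℝ] 𝔤 => B.flip) :=
    (ContinuousLinearMap.flipₗᵢ ℝ V W 𝔤).toContinuousLinearEquiv.toContinuousLinearMap.differentiable
  exact DifferentiableAt.comp (𝕜 := ℝ) (E := E) (F := V →L[ℝ] W →L[ℝ] 𝔤)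
    (G := W →L[ℝ] V →L[ℝ] 𝔤) y (h (f y)) hf

theorem differentiableAt_curvBil (ad : 𝔤 →L[ℝ] 𝔤 →L[ℝ] 𝔤) {a : E → E →L[ℝ] 𝔤} {y : E}
    (ha : ContDiffAt ℝ 2 a y) : DifferentiableAt ℝ (curvBil ad a) y := by
  have h1 : DifferentiableAt ℝ a y := ha.differentiableAt (by norm_num)
  have h2 : DifferentiableAt ℝ (fderiv ℝ a) y :=
    (ha.fderiv_right (m := 1) (by norm_num)).differentiableAt (by norm_num)
  have h3 : DifferentiableAt ℝ (fun z => (fderiv ℝ a z).flip) y :=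
    differentiableAt_flip h2
  have h4 : DifferentiableAt ℝ (fun z => ((ad.comp (a z)).flip.comp (a z)).flip) y :=
    differentiableAt_flip ((differentiableAt_flip
      ((differentiableAt_const ad).clm_comp h1)).clm_comp h1)
  exact DifferentiableAt.add (𝕜 := ℝ) (E := E) (F := E →L[ℝ] E →L[ℝ] 𝔤) (h2.sub h3) h4

theorem fderiv_curvBil (ad : 𝔤 →L[ℝ] 𝔤 →L[ℝ] 𝔤) {a : E → E →L[ℝ] 𝔤} {y : E}
    (ha : ContDiffAt ℝ 2 a y) (w u v : E) :
    fderiv ℝ (curvBil ad a) y w u v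
      = fderiv ℝ (fderiv ℝ a) y w u v - fderiv ℝ (fderiv ℝ a) y w v u
        + ad (fderiv ℝ a y w u) (a y v) + ad (a y u) (fderiv ℝ a y w v) := by
  have h1 : DifferentiableAt ℝ a y := ha.differentiableAt (by norm_num)
  have h2 : DifferentiableAt ℝ (fderiv ℝ a) y :=
    (ha.fderiv_right (m := 1) (by norm_num)).differentiableAt (by norm_num)
  have e : ∀ x : E, HasFDerivAt (fun z => a z x) ((fderiv ℝ a y).flip x) y := fun x => by
    simpa using h1.hasFDerivAt.clm_apply (hasFDerivAt_const x y)
  have e2 : ∀ x x' : E, HasFDerivAt (fun z => fderiv ℝ a z x x')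
      (((fderiv ℝ (fderiv ℝ a) y).flip x).flip x') y := fun x x' => by
    simpa using (h2.hasFDerivAt.clm_apply (hasFDerivAt_const x y)).clm_apply
      (hasFDerivAt_const x' y)
  have h3 : HasFDerivAt (fun z => curvBil ad a z u v)
      ((fderiv ℝ (curvBil ad a) y).flip u |>.flip v) y := by
    simpa using ((differentiableAt_curvBil ad ha).hasFDerivAt.clm_apply
      (hasFDerivAt_const u y)).clm_apply (hasFDerivAt_const v y)
  have h4 := ((e2 u v).sub (e2 v u)).add
    (((ad.hasFDerivAt.comp y (e u))).clm_apply (e v))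
  have h5 := congrArg (fun T : E →L[ℝ] 𝔤 => T w) (h3.unique h4)
  simp only [ContinuousLinearMap.flip_apply, add_apply, sub_apply,
    ContinuousLinearMap.comp_apply, Function.comp_apply] at h5
  rw [h5]
  abel

/-- In the cyclic sum the second derivatives of `a` cancel by their symmetry, the terms with one
derivative cancel by skewness of `ad`, and the cubic terms by the Jacobi identity. -/
theorem bianchi {ad : 𝔤 →L[ℝ] 𝔤 →L[ℝ] 𝔤} (had : ∀ x z, ad x z = -ad z x)
    (hjac : ∀ x z t, ad x (ad z t) + ad z (ad t x) + ad t (ad x z) = 0)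
    {a : E → E →L[ℝ] 𝔤} {y : E} (ha : ContDiffAt ℝ 2 a y) (u v w : E) :
    (fderiv ℝ (curvBil ad a) y u v w + ad (a y u) (curvBil ad a y v w))
      + (fderiv ℝ (curvBil ad a) y v w u + ad (a y v) (curvBil ad a y w u))
      + (fderiv ℝ (curvBil ad a) y w u v + ad (a y w) (curvBil ad a y u v)) = 0 := by
  have hsymm : ∀ p q, fderiv ℝ (fderiv ℝ a) y p q = fderiv ℝ (fderiv ℝ a) y q p := fun p q =>
    ha.isSymmSndFDerivAt (by simp) p q
  simp only [fderiv_curvBil ad ha, curvBil, add_apply, sub_apply, ContinuousLinearMap.flip_apply,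
    ContinuousLinearMap.bilinearComp_apply, map_add, map_sub]
  rw [hsymm v u, hsymm w u, hsymm w v, had (fderiv ℝ a y u v), had (fderiv ℝ a y v w),
    had (fderiv ℝ a y w u)]
  have := hjac (a y u) (a y v) (a y w)
  rw [← this]
  abel

end Bianchi

section CurvatureForm

variable {E : Type*} [NormedAddCommGroup E] [NormedSpace ℂ E] [FiniteDimensional ℂ E]
variable {𝔤 : Type*} [NormedAddCommGroup 𝔤] [NormedSpace ℝ 𝔤]

/-- Alternating `(u, v) ↦ ad (a u) (a v)` doubles it, by skewness of `ad`, which accounts for the `1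
/ 2` in `curv`. -/
theorem bilForm_curv {ad : 𝔤 →L[ℝ] 𝔤 →L[ℝ] 𝔤} (had : ∀ x z, ad x z = -ad z x)
    {a : E → E →L[ℝ] 𝔤} {y : E} (ha : DifferentiableAt ℝ a y) :
    bilForm (curv ad a y) = curvBil ad a y := by
  ext u v
  have h1 : HasFDerivAt (fun z => oneForm (a z))
      ((ContinuousAlternatingMap.ofSubsingletonLIE (𝕜 := ℝ) (E := E) (F := 𝔤)
        (0 : Fin 1)).toContinuousLinearEquiv.toContinuousLinearMap.comp (fderiv ℝ a y)) y :=
    (ContinuousAlternatingMap.ofSubsingletonLIE (𝕜 := ℝ) (E := E) (F := 𝔤)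
        (0 : Fin 1)).toContinuousLinearEquiv.toContinuousLinearMap.hasFDerivAt.comp y
      ha.hasFDerivAt
  have h2 : ∀ w x : E, fderiv ℝ (fun z => oneForm (a z)) y w (fun _ => x) = fderiv ℝ a y w x :=
    fun w x => by rw [h1.fderiv]; rfl
  have h3 : ∀ w x : E, actForm ad (a y) (oneForm (a y)) w (fun _ => x) = ad (a y w) (a y x) :=
    fun w x => rfl
  have r0 : Fin.removeNth 0 ![u, v] = fun _ : Fin 1 => v := by
    ext i; fin_cases i; rfl
  have r1 : Fin.removeNth 1 ![u, v] = fun _ : Fin 1 => u := by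
    ext i; fin_cases i; rfl
  rw [bilForm_apply, curv, ContinuousAlternatingMap.add_apply, ContinuousAlternatingMap.smul_apply,
    extDeriv, ContinuousAlternatingMap.alternatizeUncurryFin_apply,
    ContinuousAlternatingMap.alternatizeUncurryFin_apply, Fin.sum_univ_two, Fin.sum_univ_two, r0,
    r1]
  simp only [Matrix.cons_val_zero, Matrix.cons_val_one, h2, h3, curvBil]
  rw [had (a y v) (a y u)]
  simp only [Fin.val_zero, Fin.val_one, pow_zero, pow_one, add_apply, sub_apply,
    ContinuousLinearMap.flip_apply, ContinuousLinearMap.bilinearComp_apply]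
  module

end CurvatureForm

/-! ### Kähler metrics in holomorphic coordinates -/

section LocalKaehler

variable {E : Type*} [NormedAddCommGroup E] [NormedSpace ℂ E]

theorem J_J (u : E) : J E (J E u) = -u := by simp [smul_smul]

/-- `γ` is a Kähler metric near `y`, in holomorphic coordinates. -/
structure IsKaehlerNear (γ : E → E →L[ℝ] E →L[ℝ] ℝ) (y : E) : Prop where
  metric : ∀ᶠ z in nhds y, IsMetric (γ z)
  hermitian : ∀ᶠ z in nhds y, ∀ u v, γ z (J E u) (J E v) = γ z u v
  differentiableAt : DifferentiableAt ℝ γ y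
  closed : extDeriv (fun z => fundForm (γ z)) y = 0

namespace IsKaehlerNear

variable {γ : E → E →L[ℝ] E →L[ℝ] ℝ} {y : E} (h : IsKaehlerNear γ y)
include h

theorem hasFDerivAt_apply (v w : E) :
    HasFDerivAt (fun z => γ z v w) (((fderiv ℝ γ y).flip v).flip w) y := by
  simpa using (h.differentiableAt.hasFDerivAt.clm_apply (hasFDerivAt_const v y)).clm_apply
    (hasFDerivAt_const w y)

theorem fderiv_symm (u v w : E) : fderiv ℝ γ y u v w = fderiv ℝ γ y u w v := by
  have h1 : (fun z => γ z v w) =ᶠ[nhds y] fun z => γ z w v :=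
    h.metric.mono fun z hz => hz.symm v w
  have h2 := (h.hasFDerivAt_apply v w).unique ((h.hasFDerivAt_apply w v).congr_of_eventuallyEq h1)
  exact congrArg (fun T : E →L[ℝ] ℝ => T u) h2

theorem fderiv_J (u v w : E) : fderiv ℝ γ y u (J E v) (J E w) = fderiv ℝ γ y u v w := by
  have h1 : (fun z => γ z (J E v) (J E w)) =ᶠ[nhds y] fun z => γ z v w :=
    h.hermitian.mono fun z hz => hz v w
  have h2 := (h.hasFDerivAt_apply _ _).unique ((h.hasFDerivAt_apply v w).congr_of_eventuallyEq h1)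
  exact congrArg (fun T : E →L[ℝ] ℝ => T u) h2

theorem differentiableAt_fundForm : DifferentiableAt ℝ (fun z => fundForm (γ z)) y := by
  have h1 : DifferentiableAt ℝ (fun z => ((ContinuousAlternatingMap.ofSubsingletonLIE (𝕜 := ℝ)
      (E := E) (F := ℝ) (0 : Fin 1)).toContinuousLinearEquiv.toContinuousLinearMap).comp
      ((γ z).comp (J E))) y :=
    (differentiableAt_const _).clm_comp (h.differentiableAt.clm_comp (differentiableAt_const _))
  exact ((ContinuousAlternatingMap.alternatizeUncurryFinCLM ℝ E ℝ).differentiableAt.comp y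
    h1).const_smul (1 / 2 : ℝ)

theorem fderiv_closed (u v w : E) :
    fderiv ℝ γ y u (J E v) w + fderiv ℝ γ y v (J E w) u + fderiv ℝ γ y w (J E u) v = 0 := by
  have h0 : extDeriv (fun z => fundForm (γ z)) y ![u, v, w] = 0 := by
    rw [h.closed]
    rfl
  rw [extDeriv_apply h.differentiableAt_fundForm] at h0
  replace h0 := (Fin.sum_univ_three _).symm.trans h0
  have h1 : ∀ q : Fin 2 → E, ∀ p : E,
      fderiv ℝ (fun z => fundForm (γ z) q) y p = fderiv ℝ γ y p (J E (q 0)) (q 1) := fun q p => by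
    have h2 : (fun z => fundForm (γ z) q) =ᶠ[nhds y] fun z => γ z (J E (q 0)) (q 1) := by
      filter_upwards [h.metric, h.hermitian] with z hz hz'
      exact fundForm_apply (γ z) hz.symm hz' q
    rw [h2.fderiv_eq, (h.hasFDerivAt_apply _ _).fderiv]
    rfl
  simp only [h1] at h0
  have e0 : Fin.removeNth 0 ![u, v, w] = ![v, w] := by ext i; fin_cases i <;> rfl
  have e1 : Fin.removeNth 1 ![u, v, w] = ![u, w] := by ext i; fin_cases i <;> rfl
  have e2 : Fin.removeNth 2 ![u, v, w] = ![u, v] := by ext i; fin_cases i <;> rfl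
  rw [e0, e1, e2] at h0
  simp only [Matrix.cons_val_zero, Matrix.cons_val_one, Matrix.cons_val] at h0
  -- `J`-invariance turns the alternating sum of `extDeriv_apply` into a cyclic one.
  have e3 : fderiv ℝ γ y v (J E w) u = -fderiv ℝ γ y v (J E u) w := by
    rw [← h.fderiv_J v (J E w) u, J_J, h.fderiv_symm]
    simp
  rw [e3]
  simpa [sub_eq_add_neg] using h0

/-- `J` is an isometry with `J² = -1`, hence skew. The relation is needed near `y`, because it is
used under a derivative. -/
theorem sharp_comp_J [FiniteDimensional ℂ E] : ∀ᶠ z in nhds y, ∀ β : E →L[ℝ] ℝ,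
    sharp (γ z) (β.comp (J E)) = -J E (sharp (γ z) β) := by
  filter_upwards [h.metric, h.hermitian] with z hz hz' β
  refine hz.ext fun k => ?_
  rw [hz.apply_sharp, map_neg, neg_apply, ContinuousLinearMap.comp_apply, ← hz' (J E _), J_J,
    map_neg, neg_apply, neg_neg, hz.apply_sharp]

end IsKaehlerNear

end LocalKaehler

section PrecompJ

variable {E : Type*} [NormedAddCommGroup E] [NormedSpace ℂ E]
variable {W : Type*} [NormedAddCommGroup W] [NormedSpace ℝ W]

/-- Precomposition of the first argument with `J`. -/
def precompJ (Z : E → E →L[ℝ] E →L[ℝ] W) (z : E) : E →L[ℝ] E →L[ℝ] W := (Z z).comp (J E)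

@[simp] theorem precompJ_apply (Z : E → E →L[ℝ] E →L[ℝ] W) (z u v : E) :
    precompJ Z z u v = Z z (J E u) v := rfl

theorem differentiableAt_precompJ {Z : E → E →L[ℝ] E →L[ℝ] W} {y : E}
    (hZ : DifferentiableAt ℝ Z y) :
    DifferentiableAt ℝ (precompJ Z) y :=
  hZ.clm_comp (differentiableAt_const _)

end PrecompJ

/-! ### Moving `J` through a divergence, and the divergence of `F(J·, J·)` -/

section CovDiv

variable {E : Type*} [NormedAddCommGroup E] [NormedSpace ℂ E] [FiniteDimensional ℂ E]
variable {𝔤 : Type*} [NormedAddCommGroup 𝔤] [NormedSpace ℝ 𝔤]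
variable {W : Type*} [NormedAddCommGroup W] [NormedSpace ℝ W]

/-- `∑_k ∇_{A e_k} (√g Z^{k β})`; for `A = 1` this is `√g` times the divergence of `Z`. -/
def covDiv (γ : E → E →L[ℝ] E →L[ℝ] ℝ) (ρ : 𝔤 →L[ℝ] W →L[ℝ] W) (a : E → E →L[ℝ] 𝔤)
    (Z : E → E →L[ℝ] E →L[ℝ] W) (y : E) (A : E →L[ℝ] E) (β : E →L[ℝ] ℝ) : W :=
  ∑ k, covFun ρ a (field γ Z (rcoord k) β) y (A (rbasis E k))

variable {γ : E → E →L[ℝ] E →L[ℝ] ℝ} {y : E}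

/-- The contraction `Λ F` of a bilinear map with the fundamental form. -/
def hat (γ : E → E →L[ℝ] E →L[ℝ] ℝ) (F : E → E →L[ℝ] E →L[ℝ] W) (z : E) : W :=
  (1 / 2 : ℝ) • ∑ k, F z (rbasis E k) (J E (sharp (γ z) (rcoord k)))

/-- The contraction of the direction of differentiation with the first slot is invariant under `J`.
The matrix of `J` is constant in the coordinates, so it can be taken out of the derivative even
though the metric varies. -/
theorem covDiv_precompJ_J (h : IsKaehlerNear γ y) (ρ : 𝔤 →L[ℝ] W →L[ℝ] W) (a : E → E →L[ℝ] 𝔤)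
    {Z : E → E →L[ℝ] E →L[ℝ] W} (hZ : DifferentiableAt ℝ Z y) (β : E →L[ℝ] ℝ) :
    covDiv γ ρ a (precompJ Z) y (J E) β = covDiv γ ρ a Z y (.id ℝ E) β := by
  have hd := fun k => differentiableAt_field h.metric.self_of_nhds h.differentiableAt hZ
    (rcoord k) β
  have hJ : ∀ k, (rcoord k).comp (J E)
      = ∑ j, rcoord (E := E) k (J E (rbasis E j)) • rcoord j := fun k => by
    ext u
    conv_lhs => rw [← (rbasis E).sum_repr u]
    simp only [map_sum, map_smul, sum_apply, smul_apply, rcoord_apply, smul_eq_mul, mul_comm,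
      ContinuousLinearMap.comp_apply]
  have h1 : ∀ k, covFun ρ a (field γ (precompJ Z) (rcoord k) β) y
      = ∑ j, (-rcoord k (J E (rbasis E j))) • covFun ρ a (field γ Z (rcoord j) β) y := fun k => by
    have e : field γ (precompJ Z) (rcoord k) β =ᶠ[nhds y] fun z => ∑ j,
        (-rcoord k (J E (rbasis E j))) • field γ Z (rcoord j) β z := by
      filter_upwards [h.sharp_comp_J] with z hz
      have e1 : J E (sharp (γ z) (rcoord k))
          = ∑ j, (-rcoord k (J E (rbasis E j))) • sharp (γ z) (rcoord j) := by
        rw [← neg_neg (J E _), ← hz, hJ]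
        simp only [map_sum, map_smul, neg_smul, Finset.sum_neg_distrib]
      simp only [field, precompJ_apply, e1, map_sum, map_smul, sum_apply, smul_apply,
        Finset.smul_sum]
      exact Finset.sum_congr rfl fun j _ => smul_comm _ _ _
    have e2 := covFun_sum Finset.univ ρ a (y := y)
      (f := fun j z => (-rcoord k (J E (rbasis E j))) • field γ Z (rcoord j) β z)
      (fun j _ => (hd j).fun_const_smul _)
    rw [covFun_congr ρ a e, e2]
    exact Finset.sum_congr rfl fun j _ => covFun_const_smul ρ a (hd j) _
  simp only [covDiv, h1, sum_apply, smul_apply]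
  rw [Finset.sum_comm]
  refine Finset.sum_congr rfl fun j _ => ?_
  have h2 : J E (J E (rbasis E j)) = ∑ k, rcoord k (J E (rbasis E j)) • J E (rbasis E k) := by
    conv_lhs => rw [← (rbasis E).sum_repr (J E (rbasis E j))]
    simp only [map_sum, map_smul, rcoord_apply]
  rw [J_J] at h2
  have h3 := congrArg (covFun ρ a (field γ Z (rcoord j) β) y) h2
  simp only [map_neg, map_sum, map_smul] at h3
  simp only [neg_smul, Finset.sum_neg_distrib, ContinuousLinearMap.id_apply, ← h3, neg_neg]

/-- Apply `covDiv_precompJ_J` to `precompJ Z` and use `J² = -1`. -/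
theorem covDiv_J (h : IsKaehlerNear γ y) (ρ : 𝔤 →L[ℝ] W →L[ℝ] W) (a : E → E →L[ℝ] 𝔤)
    {Z : E → E →L[ℝ] E →L[ℝ] W} (hZ : DifferentiableAt ℝ Z y) (β : E →L[ℝ] ℝ) :
    covDiv γ ρ a Z y (J E) β = -covDiv γ ρ a (precompJ Z) y (.id ℝ E) β := by
  have h1 := covDiv_precompJ_J h ρ a (differentiableAt_precompJ hZ) β
  have h2 : ∀ k, covFun ρ a (field γ (precompJ (precompJ Z)) (rcoord k) β) y
      = (-1 : ℝ) • covFun ρ a (field γ Z (rcoord k) β) y := fun k => by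
    rw [← covFun_const_smul ρ a (differentiableAt_field h.metric.self_of_nhds h.differentiableAt hZ
      (rcoord k) β)]
    congr 1
    funext z
    simp only [field, precompJ_apply, J_J, map_neg, neg_apply]
    module
  rw [← h1]
  simp only [covDiv, h2, smul_apply, ← Finset.smul_sum]
  module

/-- By `hJ` the `J` moves to the second slot, where `sharp_comp_J` absorbs it into the frozen
covector; at `y` that covector becomes the dual of `J v`. -/
theorem covDiv_precompJ (h : IsKaehlerNear γ y) (ρ : 𝔤 →L[ℝ] W →L[ℝ] W) (a : E → E →L[ℝ] 𝔤)
    {Z : E → E →L[ℝ] E →L[ℝ] W} (hJ : ∀ z u v, Z z (J E u) v = Z z u (J E v)) (v : E)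
    (A : E →L[ℝ] E) :
    covDiv γ ρ a (precompJ Z) y A (γ y v) = covDiv γ ρ a Z y A (γ y (J E v)) := by
  have hβ : γ y (J E v) = -((γ y v).comp (J E)) := by
    ext w
    rw [neg_apply, ContinuousLinearMap.comp_apply, ← h.hermitian.self_of_nhds v, J_J]
    simp
  refine Finset.sum_congr rfl fun k _ => ?_
  rw [covFun_congr ρ a (f' := field γ Z (rcoord k) (γ y (J E v)))]
  filter_upwards [h.sharp_comp_J] with z hz
  rw [field, field, precompJ_apply, hJ, hβ, map_neg, hz, neg_neg]

/-- The divergence of `F(J ·, J ·)` is the derivative of the contraction of `F`, for a form `F`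
which satisfies the Bianchi identity. -/
theorem covDiv_comp_J (h : IsKaehlerNear γ y) (ρ : 𝔤 →L[ℝ] W →L[ℝ] W) (a : E → E →L[ℝ] 𝔤)
    {F : E → E →L[ℝ] E →L[ℝ] W} (hF : DifferentiableAt ℝ F y)
    (hFs : ∀ z u v, F z u v = -F z v u)
    (hB : ∀ u v w, (fderiv ℝ F y u v w + ρ (a y u) (F y v w))
      + (fderiv ℝ F y v w u + ρ (a y v) (F y w u))
      + (fderiv ℝ F y w u v + ρ (a y w) (F y u v)) = 0) (v : E) :
    covDiv γ ρ a (fun z => (F z).bilinearComp (J E) (J E)) y (.id ℝ E) (γ y v)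
      = -(dens (γ y) • covFun ρ a (hat γ F) y (J E v)) := by
  have hm := h.metric.self_of_nhds
  have hsh : ∀ β, HasFDerivAt (fun z => sharp (γ z) β) (fderiv ℝ (fun z => sharp (γ z) β) y) y :=
    fun β => ((differentiableAt_sharp hm h.differentiableAt).clm_apply
      (differentiableAt_const β)).hasFDerivAt
  -- `Γ` is only the derivative of the metric with one index raised, not the Christoffel symbol;
  -- minus `Γ` is the derivative of raising a frozen covector.
  set Γ : E →L[ℝ] E →L[ℝ] E :=
    (ContinuousLinearMap.compL ℝ E (E →L[ℝ] ℝ) E (sharp (γ y))).comp (fderiv ℝ γ y) with hΓ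
  have hΓa : ∀ u w, Γ u w = sharp (γ y) (fderiv ℝ γ y u w) := fun u w => rfl
  have hdsh : ∀ u β, fderiv ℝ (fun z => sharp (γ z) β) y u = -Γ u (sharp (γ y) β) := fun u β => by
    rw [fderiv_sharp_apply h.metric h.differentiableAt, hΓa]
  set DF : E →L[ℝ] E →L[ℝ] E →L[ℝ] W := fderiv ℝ F y +
    ((ContinuousLinearMap.compL ℝ E (E →L[ℝ] W) (E →L[ℝ] W)).flip (F y)).comp
      ((ContinuousLinearMap.compL ℝ E W W).comp (ρ.comp (a y))) with hDF
  have hDFa : ∀ u p q, DF u p q = fderiv ℝ F y u p q + ρ (a y u) (F y p q) := fun u p q => rfl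
  have hFd : ∀ p q : E, HasFDerivAt (fun z => F z p q) (((fderiv ℝ F y).flip p).flip q) y :=
    fun p q => by
      simpa using (hF.hasFDerivAt.clm_apply (hasFDerivAt_const p y)).clm_apply
        (hasFDerivAt_const q y)
  have hFs' : ∀ u p q, fderiv ℝ F y u p q = -fderiv ℝ F y u q p := fun u p q => by
    have h1 := hFd p q
    simp only [hFs _ p q] at h1
    have h2 := h1.unique (hFd q p).neg
    exact congrArg (fun T : E →L[ℝ] W => T u) h2
  have hDFs : ∀ u p q, DF u p q = -DF u q p := fun u p q => by
    rw [hDFa, hDFa, hFs', hFs _ p q, map_neg]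
    abel
  have halg := div_comp_J_algebra hm.dualFrames (I := J E) J_J h.hermitian.self_of_nhds
    (b' := fderiv ℝ γ y) h.fderiv_symm h.fderiv_J h.fderiv_closed (Γ := Γ)
    (fun u p q => by rw [hΓa, hm.apply_sharp]) (F := F y) (hFs y) (DF := DF) hDFs hB v
  -- The product rule: the four terms come from the density, from `F` with its gauge term, and from
  -- the two raised indices.
  have hL : ∀ k, covFun ρ a (field γ (fun z => (F z).bilinearComp (J E) (J E)) (rcoord k) (γ y v)) y
      (rbasis E k) = dens (γ y) • ((1 / 2 * ∑ m, fderiv ℝ γ y (rbasis E k) (rbasis E m)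
          (recip (γ y) m)) • F y (J E (recip (γ y) k)) (J E v)
        + DF (rbasis E k) (J E (recip (γ y) k)) (J E v)
        - F y (J E (Γ (rbasis E k) (recip (γ y) k))) (J E v)
        - F y (J E (recip (γ y) k)) (J E (Γ (rbasis E k) v))) := fun k => by
    have hJs : ∀ β, HasFDerivAt (fun z => J E (sharp (γ z) β))
        ((J E).comp (fderiv ℝ (fun z => sharp (γ z) β) y)) y := fun β =>
      (J E).hasFDerivAt.comp y (hsh β)
    have hd := (differentiableAt_dens hm h.differentiableAt).hasFDerivAt.fun_smul
      ((hF.hasFDerivAt.clm_apply (hJs (rcoord k))).clm_apply (hJs (γ y v)))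
    have e1 : field γ (fun z => (F z).bilinearComp (J E) (J E)) (rcoord k) (γ y v)
        = fun z => dens (γ z) • F z (J E (sharp (γ z) (rcoord k))) (J E (sharp (γ z) (γ y v))) :=
      rfl
    rw [e1, covFun_apply, hd.fderiv]
    simp only [add_apply, smul_apply, ContinuousLinearMap.comp_apply,
      ContinuousLinearMap.flip_apply, ContinuousLinearMap.smulRight_apply, hdsh, hm.sharp_rcoord,
      hm.sharp_apply, map_neg, neg_apply, hDFa, map_smul,
      fderiv_dens hm h.differentiableAt h.fderiv_symm]
    module
  have hR : covFun ρ a (hat γ F) y (J E v) = (1 / 2 : ℝ) • ∑ k, (DF (J E v) (rbasis E k)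
      (J E (recip (γ y) k)) - F y (rbasis E k) (J E (Γ (J E v) (recip (γ y) k)))) := by
    have hJs : ∀ β, HasFDerivAt (fun z => J E (sharp (γ z) β))
        ((J E).comp (fderiv ℝ (fun z => sharp (γ z) β) y)) y := fun β =>
      (J E).hasFDerivAt.comp y (hsh β)
    have hd : HasFDerivAt (hat γ F) _ y := (HasFDerivAt.fun_sum fun k (_ : k ∈ Finset.univ) =>
      (hF.hasFDerivAt.clm_apply (hasFDerivAt_const (rbasis E k) y)).clm_apply
        (hJs (rcoord k))).const_smul (1 / 2 : ℝ)
    rw [covFun_apply, hd.fderiv, hat]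
    simp only [add_apply, smul_apply, sum_apply, ContinuousLinearMap.comp_apply,
      ContinuousLinearMap.flip_apply, zero_apply, map_zero, zero_add, hdsh,
      hm.sharp_rcoord, map_neg, hDFa, map_smul, map_sum, ← smul_add, ← Finset.sum_add_distrib]
    congr 1
    refine Finset.sum_congr rfl fun k _ => ?_
    abel
  simp only [covDiv, ContinuousLinearMap.id_apply, hL, ← Finset.smul_sum]
  rw [halg, hR, smul_neg]

end CovDiv

/-! ### Type decomposition of forms and of derivatives -/

section Types

variable {E : Type*} [NormedAddCommGroup E] [NormedSpace ℂ E]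
variable {V : Type*} [NormedAddCommGroup V] [NormedSpace ℝ V]

/-- The part of a complex `2`-form of type `(0, 2)` for `ε = 1`, and `(2, 0)` for `ε = -1`. -/
def typePart (ε : ℝ) (α : E [⋀^Fin 2]→L[ℝ] (V × V)) : E [⋀^Fin 2]→L[ℝ] (V × V) :=
  (1 / 4 : ℝ) • (α - α.compContinuousLinearMap (J E) + ε • imulForm (derJ α))

theorem part02_eq (α : E [⋀^Fin 2]→L[ℝ] (V × V)) : part02 α = typePart 1 α := by
  rw [part02, typePart, one_smul]

theorem part20_eq (α : E [⋀^Fin 2]→L[ℝ] (V × V)) : part20 α = typePart (-1) α := by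
  rw [part20, typePart, sub_eq_add_neg]
  congr 2
  exact (neg_one_smul ℝ (imulForm (derJ α))).symm

/-- The anti-invariant part `F - F(J ·, J ·)` of a bilinear map. -/
def antiInv (F : E → E →L[ℝ] E →L[ℝ] V) (z : E) : E →L[ℝ] E →L[ℝ] V :=
  F z - (F z).bilinearComp (J E) (J E)

theorem antiInv_apply (F : E → E →L[ℝ] E →L[ℝ] V) (z u v : E) :
    antiInv F z u v = F z u v - F z (J E u) (J E v) := rfl

theorem antiInv_J (F : E → E →L[ℝ] E →L[ℝ] V) (z u v : E) :
    antiInv F z (J E u) v = antiInv F z u (J E v) := by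
  rw [antiInv_apply, antiInv_apply, J_J, J_J, map_neg, map_neg, neg_apply]
  abel

theorem typePart_complexify_apply (ε : ℝ) (α : E [⋀^Fin 2]→L[ℝ] V) (u v : E) :
    bilForm (typePart ε (complexify α)) u v
      = (1 / 4 : ℝ) • (antiInv (fun _ => bilForm α) 0 u v,
          ε • precompJ (antiInv (fun _ => bilForm α)) 0 u v) := by
  have h1 : (fun i => J E (![u, v] i)) = ![J E u, J E v] := by
    funext i; fin_cases i <;> rfl
  have h2 : (complexify α).compContinuousLinearMap (J E) ![u, v] = complexify α ![J E u, J E v] :=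
    congrArg (complexify α) h1
  have h3 : ∀ w : Fin 2 → E, complexify α w = (α w, 0) := fun w => rfl
  have h4 : ∀ (β : E [⋀^Fin 2]→L[ℝ] (V × V)) (w : Fin 2 → E),
      imulForm β w = (-(β w).2, (β w).1) := fun β w => rfl
  have h5 : α ![J E (J E u), J E v] = -α ![u, J E v] := by
    rw [← bilForm_apply, ← bilForm_apply, J_J, map_neg, neg_apply]
  rw [bilForm_apply, typePart, ContinuousAlternatingMap.smul_apply,
    ContinuousAlternatingMap.add_apply, ContinuousAlternatingMap.sub_apply,
    ContinuousAlternatingMap.smul_apply, h2, h4, derJ_apply, h3, h3, h3, h3, precompJ_apply,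
    antiInv_apply, antiInv_apply]
  simp only [bilForm_apply, h5, sub_neg_eq_add]
  ext <;> simp

variable {k : ℕ}

/-- The `(1,0)`-part of a complex linear map for `ε = 1`, and the `(0,1)`-part for `ε = -1`. -/
def typeProj (ε : ℝ) : (E →L[ℝ] V × V) →ₗ[ℝ] (E →L[ℝ] V × V) where
  toFun D := (1 / 2 : ℝ) • (D - ε • (imul V).comp (D.comp (J E)))
  map_add' D D' := by
    simp only [ContinuousLinearMap.add_comp, ContinuousLinearMap.comp_add]
    module
  map_smul' r D := by
    simp only [ContinuousLinearMap.smul_comp, ContinuousLinearMap.comp_smul, RingHom.id_apply]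
    module

theorem typeProj_apply (ε : ℝ) (D : E →L[ℝ] V × V) (u : E) : typeProj ε D u =
    (1 / 2 : ℝ) • (D u - ε • (-(D (J E u)).2, (D (J E u)).1)) := rfl

theorem covFun_prodMk (ad : V →L[ℝ] V →L[ℝ] V) (a : E → E →L[ℝ] V) {f f' : E → V} {y : E}
    (hf : DifferentiableAt ℝ f y) (hf' : DifferentiableAt ℝ f' y) (u : E) :
    covFun (adC ad) a (fun z => (f z, f' z)) y u = (covFun ad a f y u, covFun ad a f' y u) := by
  rw [covFun_apply, (hf.hasFDerivAt.prodMk hf'.hasFDerivAt).fderiv]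
  rfl

/-- The result is also the sum of the unprojected `D k (e k)`: under `hQJ` and `hPJ` the
complementary type of derivative contributes nothing. In the application this says that `d_A^*` and
`∂̄_A^*` agree on `F^{0,2}`, and likewise `d_A^*` and `∂_A^*` on `F^{2,0}`. -/
theorem sum_typeProj {ι : Type*} [Fintype ι] {ε : ℝ} (hε : ε * ε = 1) {D : ι → E →L[ℝ] V × V}
    {P Q : ι → E →L[ℝ] V} {e : ι → E} (hD : ∀ k u, D k u = (1 / 4 : ℝ) • (P k u, ε • Q k u))
    {p q : V} (hP : ∑ k, P k (e k) = p) (hQ : ∑ k, Q k (e k) = q)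
    (hQJ : ∑ k, Q k (J E (e k)) = p) (hPJ : ∑ k, P k (J E (e k)) = -q) :
    ∑ k, typeProj ε (D k) (e k) = (1 / 4 : ℝ) • (p, ε • q) := by
  have ht : ∀ k, typeProj ε (D k) (e k) = (1 / 8 : ℝ) • (P k (e k) + Q k (J E (e k)),
      ε • (Q k (e k) - P k (J E (e k)))) := fun k => by
    rw [typeProj_apply, hD, hD]
    generalize P k (e k) = p1
    generalize P k (J E (e k)) = p2
    generalize Q k (e k) = q1
    generalize Q k (J E (e k)) = q2
    simp only [Prod.smul_mk, Prod.mk_sub_mk, Prod.mk.injEq]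
    constructor
    · have hq : ε • ε • q2 = q2 := by rw [smul_smul, hε, one_smul]
      calc _ = (1 / 8 : ℝ) • (p1 + ε • ε • q2) := by module
        _ = _ := by rw [hq]
    · module
  simp only [ht]
  rw [← Finset.smul_sum]
  have hs : ∑ k, (P k (e k) + Q k (J E (e k)), ε • (Q k (e k) - P k (J E (e k))))
      = (p + p, ε • (q + q)) := by
    ext
    · rw [Prod.fst_sum, Finset.sum_add_distrib, hP, hQJ]
    · rw [Prod.snd_sum, ← Finset.smul_sum, Finset.sum_sub_distrib, hQ, hPJ, sub_neg_eq_add]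
  rw [hs, Prod.smul_mk, Prod.smul_mk, Prod.mk.injEq]
  constructor <;> module

variable [FiniteDimensional ℂ E]

/-- `typeProj` for maps with values in complex forms. -/
def typeProjForm (ε : ℝ) : (E →L[ℝ] E [⋀^Fin k]→L[ℝ] (V × V)) →ₗ[ℝ]
    (E →L[ℝ] E [⋀^Fin k]→L[ℝ] (V × V)) where
  toFun C := (1 / 2 : ℝ) • (C - ε • imulCLM (C.comp (J E)))
  map_add' C C' := by
    have : imulCLM ((C + C').comp (J E)) = imulCLM (C.comp (J E)) + imulCLM (C'.comp (J E)) := by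
      ext u v
      · simp [imulCLM, imulForm, imul]
        abel
      · simp [imulCLM, imulForm, imul]
    rw [this]
    module
  map_smul' r C := by
    have : imulCLM ((r • C).comp (J E)) = r • imulCLM (C.comp (J E)) := by
      ext u v <;> simp [imulCLM, imulForm, imul]
    rw [this, RingHom.id_apply]
    module

theorem typeProjForm_apply (ε : ℝ) (C : E →L[ℝ] E [⋀^Fin k]→L[ℝ] (V × V)) (u : E)
    (v : Fin k → E) : typeProjForm ε C u v
      = (1 / 2 : ℝ) • (C u v - ε • (-(C (J E u) v).2, (C (J E u) v).1)) := rfl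

theorem typeProjForm_tensorForm (ε : ℝ) (η : E [⋀^Fin k]→L[ℝ] ℝ) (D : E →L[ℝ] V × V) :
    typeProjForm ε ((tensorForm η).comp D) = (tensorForm η).comp (typeProj ε D) := by
  refine ContinuousLinearMap.ext fun u => ContinuousAlternatingMap.ext fun v => ?_
  rw [typeProjForm_apply, ContinuousLinearMap.comp_apply, ContinuousLinearMap.comp_apply,
    ContinuousLinearMap.comp_apply, tensorForm_apply, tensorForm_apply, tensorForm_apply,
    typeProj_apply, Prod.smul_fst, Prod.smul_snd, ← smul_neg, ← Prod.smul_mk]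
  module

theorem del_eq (ad : V →L[ℝ] V →L[ℝ] V) (a : E → E →L[ℝ] V) (φ : E → E [⋀^Fin k]→L[ℝ] (V × V))
    (y : E) : del ad a φ y = .alternatizeUncurryFin (typeProjForm 1 (covDeriv (adC ad) a φ y)) := by
  rw [del]
  congr 1
  change _ = (1 / 2 : ℝ) • (covDeriv (adC ad) a φ y
    - (1 : ℝ) • imulCLM ((covDeriv (adC ad) a φ y).comp (J E)))
  rw [one_smul]

theorem delbar_eq (ad : V →L[ℝ] V →L[ℝ] V) (a : E → E →L[ℝ] V)
    (φ : E → E [⋀^Fin k]→L[ℝ] (V × V)) (y : E) :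
    delbar ad a φ y = .alternatizeUncurryFin (typeProjForm (-1) (covDeriv (adC ad) a φ y)) := by
  rw [delbar]
  congr 1
  change _ = (1 / 2 : ℝ) • (covDeriv (adC ad) a φ y
    - (-1 : ℝ) • imulCLM ((covDeriv (adC ad) a φ y).comp (J E)))
  rw [sub_eq_add_neg]
  congr 2
  exact (neg_neg _).symm.trans (congrArg Neg.neg (neg_one_smul ℝ _).symm)

end Types

/-! ### The identities in a local gauge -/

section LocalTheorem

variable {E : Type*} [NormedAddCommGroup E] [NormedSpace ℂ E]
variable {𝔤 : Type*} [NormedAddCommGroup 𝔤] [NormedSpace ℝ 𝔤]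
variable {γ : E → E →L[ℝ] E →L[ℝ] ℝ} {y : E}

/-- Positive dimension is essential: for `E = 0` the natural subtraction truncates. -/
theorem rdim_sub_add (hpos : 0 < Module.finrank ℂ E) : rdim E - 2 + 2 = rdim E := by
  have : rdim E = Module.finrank ℂ E * 2 := rfl
  omega

theorem differentiableAt_comp_J {F : E → E →L[ℝ] E →L[ℝ] 𝔤} (hFd : DifferentiableAt ℝ F y) :
    DifferentiableAt ℝ (fun z => (F z).bilinearComp (J E) (J E)) y := by
  have h1 : DifferentiableAt ℝ (fun z => ((F z).comp (J E)).flip) y :=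
    differentiableAt_flip (hFd.clm_comp (differentiableAt_const (J E)))
  exact differentiableAt_flip (h1.clm_comp (differentiableAt_const (J E)))

theorem differentiableAt_antiInv {F : E → E →L[ℝ] E →L[ℝ] 𝔤} (hFd : DifferentiableAt ℝ F y) :
    DifferentiableAt ℝ (antiInv F) y :=
  DifferentiableAt.fun_sub (𝕜 := ℝ) (E := E) (F := E →L[ℝ] E →L[ℝ] 𝔤) hFd
    (differentiableAt_comp_J hFd)

theorem differentiableAt_bilForm_typePart (ε : ℝ) {Φ : E → E [⋀^Fin 2]→L[ℝ] 𝔤}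
    (hHd : DifferentiableAt ℝ (antiInv fun z => bilForm (Φ z)) y) :
    DifferentiableAt ℝ (fun z => bilForm (typePart ε (complexify (Φ z)))) y := by
  have hφe : (fun z => bilForm (typePart ε (complexify (Φ z)))) = fun z => (1 / 4 : ℝ) •
      ((ContinuousLinearMap.compL ℝ E 𝔤 (𝔤 × 𝔤) (.inl ℝ 𝔤 𝔤)).comp
          ((antiInv fun z => bilForm (Φ z)) z)
        + (ContinuousLinearMap.compL ℝ E 𝔤 (𝔤 × 𝔤) (ε • .inr ℝ 𝔤 𝔤)).comp
          (precompJ (antiInv fun z => bilForm (Φ z)) z)) := by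
    funext z
    ext1 u
    ext1 w
    rw [typePart_complexify_apply]
    simp [antiInv_apply]
  have e1 : DifferentiableAt ℝ (fun z => (ContinuousLinearMap.compL ℝ E 𝔤 (𝔤 × 𝔤)
      (.inl ℝ 𝔤 𝔤)).comp ((antiInv fun z => bilForm (Φ z)) z)) y :=
    (differentiableAt_const _).clm_comp hHd
  have e2 : DifferentiableAt ℝ (fun z => (ContinuousLinearMap.compL ℝ E 𝔤 (𝔤 × 𝔤)
      (ε • .inr ℝ 𝔤 𝔤)).comp (precompJ (antiInv fun z => bilForm (Φ z)) z)) y :=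
    (differentiableAt_const _).clm_comp (differentiableAt_precompJ hHd)
  rw [hφe]
  exact DifferentiableAt.fun_const_smul (DifferentiableAt.fun_add (𝕜 := ℝ) (E := E)
    (F := E →L[ℝ] E →L[ℝ] 𝔤 × 𝔤) e1 e2) _

variable [FiniteDimensional ℂ E]

theorem differentiableAt_hat (h : IsKaehlerNear γ y) {F : E → E →L[ℝ] E →L[ℝ] 𝔤}
    (hF : DifferentiableAt ℝ F y) : DifferentiableAt ℝ (hat γ F) y := by
  have hsh := differentiableAt_sharp h.metric.self_of_nhds h.differentiableAt
  refine DifferentiableAt.fun_const_smul (DifferentiableAt.fun_sum fun k _ => ?_) (1 / 2 : ℝ)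
  exact (hF.clm_apply (differentiableAt_const _)).clm_apply
    ((J E).differentiableAt.comp y (hsh.clm_apply (differentiableAt_const _)))

theorem covDeriv_complexify_contractOmega (h : IsKaehlerNear γ y) (ad : 𝔤 →L[ℝ] 𝔤 →L[ℝ] 𝔤)
    (a : E → E →L[ℝ] 𝔤) {F : E → E [⋀^Fin 2]→L[ℝ] 𝔤}
    (hF : DifferentiableAt ℝ (fun z => bilForm (F z)) y) (u : E) (v : Fin 0 → E) :
    covDeriv (adC ad) a (fun z => complexify (contractOmega (γ z) (F z))) y u v
      = (covFun ad a (hat γ fun z => bilForm (F z)) y u, 0) := by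
  have hd := differentiableAt_hat h hF
  have h1 : (fun z => complexify (contractOmega (γ z) (F z))) =ᶠ[nhds y] fun z =>
      ContinuousAlternatingMap.constOfIsEmptyLIE ℝ E (𝔤 × 𝔤) (Fin 0)
        (hat γ (fun z => bilForm (F z)) z, 0) := by
    filter_upwards [h.metric] with z hz
    ext w
    · simp only [hat, hz.sharp_rcoord, bilForm_apply]
      rw [Subsingleton.elim w ![]]
      simp [complexify, contractOmega, Prod.fst_sum]
    · simp [complexify]
  have h2 : HasFDerivAt (fun z => ContinuousAlternatingMap.constOfIsEmptyLIE ℝ E (𝔤 × 𝔤) (Fin 0)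
        (hat γ (fun z => bilForm (F z)) z, (0 : 𝔤)))
      (((ContinuousAlternatingMap.constOfIsEmptyLIE ℝ E (𝔤 × 𝔤)
        (Fin 0)).toContinuousLinearEquiv.toContinuousLinearMap).comp
        ((fderiv ℝ (hat γ fun z => bilForm (F z)) y).prod 0)) y :=
    ((ContinuousAlternatingMap.constOfIsEmptyLIE ℝ E (𝔤 × 𝔤)
        (Fin 0)).toContinuousLinearEquiv.toContinuousLinearMap).hasFDerivAt.comp y
      (hd.hasFDerivAt.prodMk (hasFDerivAt_const 0 y))
  rw [covDeriv_congr _ _ h1, covDeriv_apply, h2.fderiv, covFun_apply]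
  ext
  · simp [adC]
  · simp [adC]

theorem covDiv_antiInv (h : IsKaehlerNear γ y) (ad : 𝔤 →L[ℝ] 𝔤 →L[ℝ] 𝔤) (a : E → E →L[ℝ] 𝔤)
    {F : E → E →L[ℝ] E →L[ℝ] 𝔤} (hFd : DifferentiableAt ℝ F y) (A : E →L[ℝ] E)
    (β : E →L[ℝ] ℝ) : covDiv γ ad a (antiInv F) y A β = covDiv γ ad a F y A β
      - covDiv γ ad a (fun z => (F z).bilinearComp (J E) (J E)) y A β := by
  have h1 : ∀ k, covFun ad a (field γ (antiInv F) (rcoord k) β) y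
      = covFun ad a (field γ F (rcoord k) β) y
        - covFun ad a (field γ (fun z => (F z).bilinearComp (J E) (J E)) (rcoord k) β) y :=
    fun k => by
      have hm := h.metric.self_of_nhds
      have e1 := differentiableAt_field hm h.differentiableAt hFd (rcoord k) β
      have e2 := differentiableAt_field hm h.differentiableAt (differentiableAt_comp_J hFd)
        (rcoord k) β
      have e3 : field γ (antiInv F) (rcoord k) β = fun z => field γ F (rcoord k) β z
          - field γ (fun z => (F z).bilinearComp (J E) (J E)) (rcoord k) β z := by
        funext z
        exact smul_sub _ _ _
      ext u
      rw [e3, sub_apply, covFun_apply, covFun_apply, covFun_apply, fderiv_fun_sub e1 e2,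
        sub_apply, map_sub]
      abel
  simp only [covDiv, h1, sub_apply, Finset.sum_sub_distrib]

theorem differentiableAt_bilForm_curv {ad : 𝔤 →L[ℝ] 𝔤 →L[ℝ] 𝔤} (had : ∀ x z, ad x z = -ad z x)
    {a : E → E →L[ℝ] 𝔤} (ha : ContDiffAt ℝ 2 a y) :
    (fun z => bilForm (curv ad a z)) =ᶠ[nhds y] curvBil ad a ∧
      DifferentiableAt ℝ (fun z => bilForm (curv ad a z)) y := by
  have hFe : (fun z => bilForm (curv ad a z)) =ᶠ[nhds y] curvBil ad a := by
    filter_upwards [ha.eventually (by simp)] with z hz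
    exact bilForm_curv had (hz.differentiableAt (by norm_num))
  exact ⟨hFe, (differentiableAt_curvBil ad ha).congr_of_eventuallyEq hFe⟩

/-- For a Yang-Mills connection, the divergence of the anti-invariant part of the curvature is the
derivative of the contracted curvature. -/
theorem covDiv_antiInv_curv (h : IsKaehlerNear γ y) {ad : 𝔤 →L[ℝ] 𝔤 →L[ℝ] 𝔤}
    (had : ∀ x z, ad x z = -ad z x)
    (hjac : ∀ x z t, ad x (ad z t) + ad z (ad t x) + ad t (ad x z) = 0)
    {a : E → E →L[ℝ] 𝔤} (ha : ContDiffAt ℝ 2 a y) (hpos : 0 < Module.finrank ℂ E)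
    (hYM : dCovStar γ ad a (curv ad a) y = 0) (w : E) :
    covDiv γ ad a (antiInv fun z => bilForm (curv ad a z)) y (.id ℝ E) (γ y w)
      = dens (γ y) • covFun ad a (hat γ fun z => bilForm (curv ad a z)) y (J E w) := by
  obtain ⟨hFe, hFd⟩ := differentiableAt_bilForm_curv had ha
  have hB := bianchi had hjac ha
  rw [← hFe.fderiv_eq, ← hFe.self_of_nhds] at hB
  -- The divergence formula with trivial type projection; the inverse density is nonzero and can be
  -- dropped.
  have ym : covDiv γ ad a (fun z => bilForm (curv ad a z)) y (.id ℝ E) (γ y w) = 0 := by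
    have h1 := neg_hodge_alternatize_apply h.metric h.differentiableAt ad a (φ := curv ad a) hFd
      (rdim_sub_add hpos) LinearMap.id LinearMap.id (fun _ _ => rfl) (fun _ => w)
    have h2 : dCovStar γ ad a (curv ad a) y (fun _ => w) = 0 := by rw [hYM]; rfl
    have h3 := h1.symm.trans h2
    rw [neg_eq_zero, smul_eq_zero] at h3
    exact h3.resolve_left (inv_ne_zero h.metric.self_of_nhds.dens_pos.ne')
  rw [covDiv_antiInv h ad a hFd, ym,
    covDiv_comp_J h ad a hFd (fun z u v => bilForm_swap _ u v) hB, zero_sub, neg_neg]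

theorem covFun_field_typePart (h : IsKaehlerNear γ y) (ad : 𝔤 →L[ℝ] 𝔤 →L[ℝ] 𝔤)
    (a : E → E →L[ℝ] 𝔤) (ε : ℝ) {Φ : E → E [⋀^Fin 2]→L[ℝ] 𝔤}
    (hHd : DifferentiableAt ℝ (antiInv fun z => bilForm (Φ z)) y) (α β : E →L[ℝ] ℝ) (u : E) :
    covFun (adC ad) a (field γ (fun z => bilForm (typePart ε (complexify (Φ z)))) α β) y u
      = (1 / 4 : ℝ) • (covFun ad a (field γ (antiInv fun z => bilForm (Φ z)) α β) y u,
          ε • covFun ad a (field γ (precompJ (antiInv fun z => bilForm (Φ z))) α β) y u) := by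
  have hm := h.metric.self_of_nhds
  have e1 := differentiableAt_field hm h.differentiableAt hHd α β
  have e2 := differentiableAt_field hm h.differentiableAt (differentiableAt_precompJ hHd) α β
  have e3 : field γ (fun z => bilForm (typePart ε (complexify (Φ z)))) α β = fun z =>
      (1 / 4 : ℝ) • (field γ (antiInv fun z => bilForm (Φ z)) α β z,
        ε • field γ (precompJ (antiInv fun z => bilForm (Φ z))) α β z) := by
    funext z
    rw [field, typePart_complexify_apply, smul_comm]
    congr 1
    ext
    · rfl
    · exact smul_comm _ _ _
  rw [e3, covFun_const_smul (adC ad) a (e1.prodMk (e2.fun_const_smul ε)), smul_apply,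
    covFun_prodMk ad a e1 (e2.fun_const_smul ε), covFun_const_smul ad a e2, smul_apply]

theorem neg_hodge_typePart_apply (h : IsKaehlerNear γ y) (ad : 𝔤 →L[ℝ] 𝔤 →L[ℝ] 𝔤)
    (a : E → E →L[ℝ] 𝔤) {ε : ℝ} (hε : ε * ε = 1) {Φ : E → E [⋀^Fin 2]→L[ℝ] 𝔤}
    (hΦ : DifferentiableAt ℝ (fun z => bilForm (Φ z)) y) (hpos : 0 < Module.finrank ℂ E)
    {c : E →L[ℝ] 𝔤}
    (hP : ∀ w, covDiv γ ad a (antiInv fun z => bilForm (Φ z)) y (.id ℝ E) (γ y w)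
      = dens (γ y) • c (J E w)) (v : Fin 1 → E) :
    -hodge (γ y) 1 (.alternatizeUncurryFin (typeProjForm ε (covDeriv (adC ad) a
        (fun z => hodge (γ z) (rdim E - 2) (typePart ε (complexify (Φ z)))) y))) v
      = -((1 / 4 : ℝ) • (c (J E (v 0)), -(ε • c (v 0)))) := by
  have hHd := differentiableAt_antiInv hΦ
  rw [neg_hodge_alternatize_apply h.metric h.differentiableAt (adC ad) a
    (differentiableAt_bilForm_typePart ε hHd) (rdim_sub_add hpos)
    (typeProj ε) (typeProjForm ε) (typeProjForm_tensorForm ε) v]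
  have hcov := fun k => covFun_field_typePart h ad a ε hHd (rcoord k) (γ y (v 0))
  -- The three rules for moving `J` express every sum required by `sum_typeProj` through `hP`: with
  -- `p = √g c(J v)` and `q = -√g c(v)`.
  have hQ1 := covDiv_precompJ h ad a (antiInv_J fun z => bilForm (Φ z)) (v 0) (.id ℝ E)
  have hQ2 := covDiv_precompJ_J h ad a hHd (γ y (v 0))
  have hQ3 := covDiv_J h ad a hHd (γ y (v 0))
  have hPv := hP (v 0)
  rw [hQ1] at hQ3
  rw [hP] at hQ1 hQ2 hQ3
  rw [J_J, map_neg] at hQ1 hQ3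
  simp only [covDiv, ContinuousLinearMap.id_apply] at hPv hQ1 hQ2 hQ3
  rw [sum_typeProj hε hcov hPv hQ1 hQ2 hQ3, smul_comm ε (dens (γ y)), ← Prod.smul_mk, smul_comm (1 / 4 : ℝ),
    inv_smul_smul₀ h.metric.self_of_nhds.dens_pos.ne', smul_neg]

/-- The Kähler identity for the `(0,2)`-part (`ε = 1`) and for the `(2,0)`-part (`ε = -1`) of the
curvature of a Yang-Mills connection, in a local gauge. -/
theorem codifferential_typePart (h : IsKaehlerNear γ y) {ad : 𝔤 →L[ℝ] 𝔤 →L[ℝ] 𝔤}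
    (had : ∀ x z, ad x z = -ad z x)
    (hjac : ∀ x z t, ad x (ad z t) + ad z (ad t x) + ad t (ad x z) = 0)
    {a : E → E →L[ℝ] 𝔤} (ha : ContDiffAt ℝ 2 a y)
    (hYM : dCovStar γ ad a (curv ad a) y = 0) {ε : ℝ} (hε : ε * ε = 1) :
    (2 : ℝ) • -hodge (γ y) 1 (.alternatizeUncurryFin (typeProjForm ε (covDeriv (adC ad) a
        (fun z => hodge (γ z) (rdim E - 2) (typePart ε (complexify (curv ad a z)))) y)))
      = ε • imulForm (.alternatizeUncurryFin (typeProjForm (-ε) (covDeriv (adC ad) a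
        (fun z => complexify (contractOmega (γ z) (curv ad a z))) y))) := by
  ext1 v
  rcases Nat.eq_zero_or_pos (Module.finrank ℂ E) with h0 | hpos
  -- In dimension zero the degree `rdim E - 2` is meaningless, but every `1`-form vanishes.
  · have : Subsingleton E := Module.finrank_zero_iff.1 h0
    rw [ContinuousAlternatingMap.map_coord_zero _ 0 (Subsingleton.elim _ _),
      ContinuousAlternatingMap.map_coord_zero _ 0 (Subsingleton.elim _ _)]
  · have hFd := (differentiableAt_bilForm_curv had ha).2
    have hL := neg_hodge_typePart_apply h ad a hε hFd hpos
      (covDiv_antiInv_curv h had hjac ha hpos hYM) v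
    have hR := (ContinuousAlternatingMap.alternatizeUncurryFin_apply (typeProjForm (-ε)
      (covDeriv (adC ad) a (fun z => complexify (contractOmega (γ z) (curv ad a z))) y)) v).trans
        (Fin.sum_univ_one _)
    rw [Fin.val_zero, pow_zero, one_smul, typeProjForm_apply,
      covDeriv_complexify_contractOmega h ad a hFd, covDeriv_complexify_contractOmega h ad a hFd] at hR
    have hI : ∀ β : E [⋀^Fin 1]→L[ℝ] (𝔤 × 𝔤), imulForm β v = (-(β v).2, (β v).1) := fun _ => rfl
    rw [ContinuousAlternatingMap.smul_apply, ContinuousAlternatingMap.smul_apply,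
      ContinuousAlternatingMap.neg_apply, hL, hI, hR]
    generalize covFun ad a (hat γ fun z => bilForm (curv ad a z)) y = c
    change (2 : ℝ) • -((1 / 4 : ℝ) • (c (J E (v 0)), -(ε • c (v 0))))
      = ε • (-((1 / 2 : ℝ) • (0 - -ε • c (J E (v 0)))), (1 / 2 : ℝ) • (c (v 0) - -ε • -(0 : 𝔤)))
    generalize c (J E (v 0)) = p
    generalize c (v 0) = q
    have hp : ε • ε • p = p := by rw [smul_smul, hε, one_smul]
    ext
    · calc _ = -((1 / 2 : ℝ) • p) := by simp only [Prod.smul_fst, Prod.fst_neg]; module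
        _ = -((1 / 2 : ℝ) • ε • ε • p) := by rw [hp]
        _ = _ := by simp only [Prod.smul_fst]; module
    · simp only [Prod.smul_snd, Prod.snd_neg]
      module

end LocalTheorem

/-! ### Smoothness of the local data and passage from the manifold to charts -/

section Lifts

variable {E : Type*} [NormedAddCommGroup E] [NormedSpace ℝ E]
variable {X : Type*} [TopologicalSpace X] {EX : Type*} [NormedAddCommGroup EX] [NormedSpace ℝ EX]
variable [ChartedSpace EX X] [IsManifold 𝓘(ℝ, EX) ∞ X]

/-- A constant vector is pushed forward by a smooth map to a smooth vector field along the map. -/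
theorem contMDiffOn_mfderiv_const {σ : E → X} {s : Set E} (hs : IsOpen s)
    (hσ : ContMDiffOn 𝓘(ℝ, E) 𝓘(ℝ, EX) ∞ σ s) (v : E) :
    ContMDiffOn 𝓘(ℝ, E) 𝓘(ℝ, EX).tangent ∞
      (fun z => (⟨σ z, mfderiv 𝓘(ℝ, E) 𝓘(ℝ, EX) σ z v⟩ : TangentBundle 𝓘(ℝ, EX) X)) s := by
  have : IsManifold 𝓘(ℝ, EX) 1 X := .of_le (n := ∞) (by norm_cast)
  have h1 := hσ.contMDiffOn_tangentMapWithin (m := ∞) (by norm_cast) hs.uniqueMDiffOn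
  have h2 : ContMDiffOn 𝓘(ℝ, E) 𝓘(ℝ, E).tangent ∞
      (fun z => (⟨z, v⟩ : TangentBundle 𝓘(ℝ, E) E)) s :=
    contMDiffOn_vectorSpace_iff_contDiffOn.2 contDiffOn_const
  refine (h1.comp h2 fun z hz => hz).congr fun z hz => ?_
  simp only [Function.comp, tangentMapWithin]
  rw [mfderivWithin_of_isOpen hs hz]

end Lifts

section Geometry

variable {E : Type*} [NormedAddCommGroup E] [NormedSpace ℂ E]
variable {M : Type*} [TopologicalSpace M] [ChartedSpace E M]
variable {EG : Type*} [NormedAddCommGroup EG] [NormedSpace ℝ EG]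
variable {G : Type*} [TopologicalSpace G] [ChartedSpace EG G] [Group G]

section Gauge

variable [FiniteDimensional ℂ E]
variable {EP : Type*} [NormedAddCommGroup EP] [NormedSpace ℝ EP]
variable {P : Type*} [TopologicalSpace P] [ChartedSpace EP P] [MulAction Gᵐᵒᵖ P]
variable [IsManifold 𝓘(ℝ, EP) ∞ P]

/-- As `E` is finite-dimensional, it suffices to evaluate on a constant vector `v`. The value is the
smooth function `A` on the tangent bundle of `P` composed with the smooth push-forward of `v` by
`σ`. -/
theorem contDiffOn_gaugePotential (A : PrincipalConnection EG G EP P) {σ : E → P} {s : Set E}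
    (hs : IsOpen s) (hσ : ContMDiffOn 𝓘(ℝ, E) 𝓘(ℝ, EP) ∞ σ s) :
    ContDiffOn ℝ ∞ (gaugePotential A σ) s := by
  have : FiniteDimensional ℝ E := FiniteDimensional.complexToReal E
  rw [contDiffOn_clm_apply]
  intro v
  have h1 := A.smooth.comp_contMDiffOn (contMDiffOn_mfderiv_const hs hσ v)
  exact contMDiffOn_iff_contDiffOn.1 h1

end Gauge

theorem mem_maximalAtlas_real [IsManifold 𝓘(ℂ, E) ω M] {c : OpenPartialHomeomorph M E}
    (hc : c ∈ IsManifold.maximalAtlas 𝓘(ℂ, E) ω M) :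
    c ∈ IsManifold.maximalAtlas 𝓘(ℝ, E) ω M := by
  have key : ∀ e : OpenPartialHomeomorph E E, e ∈ contDiffGroupoid ω 𝓘(ℂ, E) →
      e ∈ contDiffGroupoid ω 𝓘(ℝ, E) := fun e he => by
    rw [contDiffGroupoid, mem_groupoid_of_pregroupoid] at he ⊢
    exact ⟨ContDiffOn.restrict_scalars ℝ he.1, ContDiffOn.restrict_scalars ℝ he.2⟩
  rw [IsManifold.mem_maximalAtlas_iff] at hc ⊢
  exact fun e he => ⟨key _ (hc e he).1, key _ (hc e he).2⟩

section Metric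

variable [IsManifold 𝓘(ℂ, E) ω M] (g : RMetric E M) {c : OpenPartialHomeomorph M E}

theorem localMetric_apply (y u v : E) : localMetric g c y u v = g.inner (c.symm y)
    (mfderiv 𝓘(ℝ, E) 𝓘(ℝ, E) c.symm y u) (mfderiv 𝓘(ℝ, E) 𝓘(ℝ, E) c.symm y v) := rfl

/-- Positivity survives the pullback because the derivative of the inverse chart is injective. -/
theorem isMetric_localMetric (hc : c ∈ IsManifold.maximalAtlas 𝓘(ℂ, E) ω M) {y : E}
    (hy : y ∈ c.target) : IsMetric (localMetric g c y) := by
  have hr := mem_maximalAtlas_real hc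
  have hd : c.symm.MDifferentiable 𝓘(ℝ, E) 𝓘(ℝ, E) :=
    ⟨(contMDiffOn_symm_of_mem_maximalAtlas hr).mdifferentiableOn (by simp),
      (contMDiffOn_of_mem_maximalAtlas hr).mdifferentiableOn (by simp)⟩
  have hinj := hd.mfderiv_injective hy
  constructor
  · intro u v
    rw [localMetric_apply, localMetric_apply]
    exact g.symm (c.symm y) _ _
  · intro u hu
    rw [localMetric_apply]
    exact g.pos (c.symm y) _ fun h0 => hu (hinj (h0.trans (map_zero _).symm))

theorem contDiffOn_localMetric [FiniteDimensional ℂ E]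
    (hc : c ∈ IsManifold.maximalAtlas 𝓘(ℂ, E) ω M) :
    ContDiffOn ℝ ∞ (localMetric g c) c.target := by
  have : FiniteDimensional ℝ E := FiniteDimensional.complexToReal E
  have : IsManifold 𝓘(ℝ, E) ∞ M := .of_le (n := ω) le_top
  have hcs : ContMDiffOn 𝓘(ℝ, E) 𝓘(ℝ, E) ∞ c.symm c.target :=
    (contMDiffOn_symm_of_mem_maximalAtlas (mem_maximalAtlas_real hc)).of_le le_top
  rw [contDiffOn_clm_apply]
  intro u
  rw [contDiffOn_clm_apply]
  intro v
  have h1 := g.contMDiff.comp_contMDiffOn hcs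
  have h2 := ContMDiffOn.clm_bundle_apply₂ (F₃ := ℝ) (E₃ := fun _ : M => ℝ) h1
    (contMDiffOn_mfderiv_const c.open_target hcs u) (contMDiffOn_mfderiv_const c.open_target hcs v)
  intro z hz
  have h3 := h2 z hz
  simp only [Bundle.contMDiffWithinAt_totalSpace] at h3
  exact contMDiffWithinAt_iff_contDiffWithinAt.1 h3.2

theorem isKaehlerNear_localMetric [FiniteDimensional ℂ E] (hg : IsKaehler g)
    (hc : c ∈ IsManifold.maximalAtlas 𝓘(ℂ, E) ω M) {y : E} (hy : y ∈ c.target) :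
    IsKaehlerNear (localMetric g c) y where
  metric := (c.open_target.eventually_mem hy).mono fun z hz =>
    isMetric_localMetric g hc hz
  hermitian := (c.open_target.eventually_mem hy).mono fun z hz =>
    hg.hermitian c hc z hz
  differentiableAt := ((contDiffOn_localMetric g hc).contDiffAt
    (c.open_target.mem_nhds hy)).differentiableAt (by simp)
  closed := hg.closed c hc y hy

end Metric

section LieAlgebra

variable [FiniteDimensional ℝ EG] [LieGroup 𝓘(ℝ, EG) ∞ G]

theorem lieAd_skew (x z : EG) : lieAd EG G x z = -lieAd EG G z x := by
  have : LieGroup 𝓘(ℝ, EG) (minSmoothness ℝ 3) G := LieGroup.of_le (n := ∞) (by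
    rw [minSmoothness_of_isRCLikeNormedField]; exact WithTop.coe_le_coe.2 le_top)
  have : CompleteSpace EG := FiniteDimensional.complete ℝ EG
  exact (lie_skew (L := GroupLieAlgebra 𝓘(ℝ, EG) G) x z).symm

theorem lieAd_jacobi (x z t : EG) : lieAd EG G x (lieAd EG G z t) + lieAd EG G z (lieAd EG G t x)
    + lieAd EG G t (lieAd EG G x z) = 0 := by
  have : LieGroup 𝓘(ℝ, EG) (minSmoothness ℝ 3) G := LieGroup.of_le (n := ∞) (by
    rw [minSmoothness_of_isRCLikeNormedField]; exact WithTop.coe_le_coe.2 le_top)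
  have : CompleteSpace EG := FiniteDimensional.complete ℝ EG
  exact lie_jacobi (L := GroupLieAlgebra 𝓘(ℝ, EG) G) x z t

end LieAlgebra

end Geometry

end KaehlerYM

end

theorem mainTheorem7
    {E : Type*} [NormedAddCommGroup E] [NormedSpace ℂ E] [FiniteDimensional ℂ E]
    {M : Type*} [TopologicalSpace M] [ChartedSpace E M] [IsManifold 𝓘(ℂ, E) ω M]
    (g : KaehlerYM.RMetric E M) (hg : KaehlerYM.IsKaehler g)
    {EG : Type*} [NormedAddCommGroup EG] [NormedSpace ℝ EG] [FiniteDimensional ℝ EG]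
    {G : Type*} [TopologicalSpace G] [ChartedSpace EG G] [Group G] [LieGroup 𝓘(ℝ, EG) ∞ G]
    {EP : Type*} [NormedAddCommGroup EP] [NormedSpace ℝ EP] [FiniteDimensional ℝ EP]
    {P : Type*} [TopologicalSpace P] [ChartedSpace EP P] [IsManifold 𝓘(ℝ, EP) ∞ P]
    [MulAction Gᵐᵒᵖ P] (π : P → M) (hπ : KaehlerYM.IsPrincipalBundle E EG G EP π)
    (A : KaehlerYM.PrincipalConnection EG G EP P) (hA : KaehlerYM.IsYangMills g π A)
    (c : OpenPartialHomeomorph M E) (σ : E → P) (hσ : KaehlerYM.IsLocalGauge EP π c σ)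
    (y : E) (hy : y ∈ c.target) :
    (2 : ℝ) • KaehlerYM.delbarStar (KaehlerYM.localMetric g c) (KaehlerYM.lieAd EG G)
          (KaehlerYM.gaugePotential A σ) (KaehlerYM.curvature02 A σ) y =
        KaehlerYM.imulForm (KaehlerYM.delbar (KaehlerYM.lieAd EG G)
          (KaehlerYM.gaugePotential A σ) (KaehlerYM.curvatureHat g A c σ) y) ∧
      (2 : ℝ) • KaehlerYM.delStar (KaehlerYM.localMetric g c) (KaehlerYM.lieAd EG G)
          (KaehlerYM.gaugePotential A σ) (KaehlerYM.curvature20 A σ) y =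
        -KaehlerYM.imulForm (KaehlerYM.del (KaehlerYM.lieAd EG G)
          (KaehlerYM.gaugePotential A σ) (KaehlerYM.curvatureHat g A c σ) y) := by
  have hK := KaehlerYM.isKaehlerNear_localMetric g hg hσ.chart hy
  have ha : ContDiffAt ℝ 2 (KaehlerYM.gaugePotential A σ) y :=
    ((KaehlerYM.contDiffOn_gaugePotential A c.open_target hσ.smooth).contDiffAt
      (c.open_target.mem_nhds hy)).of_le (by norm_cast)
  -- `ε = 1` gives the `(0,2)`-identity and `ε = -1` the `(2,0)`-identity.
  have key := fun ε hε => KaehlerYM.codifferential_typePart hK (KaehlerYM.lieAd_skew (G := G))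
    KaehlerYM.lieAd_jacobi ha (hA c σ hσ y hy) (ε := ε) hε
  constructor
  · have h := key 1 (one_mul 1)
    rw [← KaehlerYM.del_eq, ← KaehlerYM.delbar_eq, one_smul] at h
    simp only [← KaehlerYM.part02_eq] at h
    exact h
  · have h := key (-1) (by norm_num)
    rw [← KaehlerYM.delbar_eq, neg_neg, ← KaehlerYM.del_eq] at h
    simp only [← KaehlerYM.part20_eq] at h
    exact h.trans (neg_one_smul ℝ _)
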